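/- Let $\mathbb{F}_q$ be the finite field with $q$ elements. The height of a polynomial $P\in\mathbb{F}_q[T][X]$ is its degree in $T$, i.e. the maximal degree in $T$ of its coefficients. If $K$ is a finite extension of $\mathbb{F}_q(T)$, the height of $\alpha\in K$ is the height of its minimal polynomial over $\mathbb{F}_q[T]$, i.e. of the irreducible polynomial in $\mathbb{F}_q[T][X]$ vanishing at $\alpha$, which is unique up to a factor in $\mathbb{F}_q^*$. For $A,B\subset K$ write $AB=\{ab : a\in A,\ b\in B\}$ and, for an integer $\nu\ge 1$, $A^{(\nu)}=\{a_1\cdots a_\nu : a_1,\dots,a_\nu\in A\}$. (i) For all $q,d$ there is a constant $C=C(q,d)>0$ such that for every extension $K$ of $\mathbb{F}_q(T)$ of degree $d$, every real $h>1$, and all finite sets $A,B\subset K$ of elements of height at most $h$, each of which contains a nonzero element, $$\#(AB)>\exp\left(-C\,\frac{h}{\sqrt{\log h}}\right)\#A\,\#B.$$ (ii) For all $q,d$ and every integer $\nu\ge 1$ there is a constant $C=C(q,d,\nu)>0$ such that for every extension $K$ of $\mathbb{F}_q(T)$ of degree $d$, every real $h>1$, and every nonempty finite set $A\subset K$ of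 elements of height at most $h$, $$\#A^{(\nu)}>\exp\left(-C\,\frac{h}{\sqrt{\log h}}\right)(\#A)^{\nu}.$$ -/

import Mathlib

open scoped Pointwise

universe u v

namespace FunctionFieldHeight

open Polynomial

variable {F : Type*} [Field F] {K : Type*} [Field K] [Algebra (RatFunc F) K]

/-- The height of `P ∈ F[T][X]`: its degree in `T`, i.e. the largest degree in `T`
of a coefficient of `P`. -/
noncomputable def polyHeight (P : F[X][X]) : ℕ :=
  P.support.sup fun i => (P.coeff i).natDegree

/-- `P` is a minimal polynomial of `α` over `F[T]`: an irreducible element of `F[T][X]`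
(so in particular without a nonconstant factor in `F[T]`) that vanishes at `α`. -/
def IsMinpoly (α : K) (P : F[X][X]) : Prop :=
  Irreducible P ∧ aeval α (P.map (algebraMap F[X] (RatFunc F))) = 0

theorem IsMinpoly.associated {α : K} {P Q : F[X][X]} (hP : IsMinpoly α P)
    (hQ : IsMinpoly α Q) : Associated P Q := by
  have hinj : Function.Injective (algebraMap F[X] (RatFunc F)) :=
    IsFractionRing.injective _ _
  have key : ∀ {R : F[X][X]}, IsMinpoly α R → R.IsPrimitive ∧
      Associated (R.map (algebraMap F[X] (RatFunc F))) (minpoly (RatFunc F) α) := by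
    intro R hR
    have hne : R.map (algebraMap F[X] (RatFunc F)) ≠ 0 :=
      (Polynomial.map_ne_zero_iff hinj).2 hR.1.ne_zero
    have hint : IsIntegral (RatFunc F) α :=
      (isAlgebraic_iff_isIntegral).1 ⟨_, hne, hR.2⟩
    have hdeg : R.natDegree ≠ 0 := by
      intro h0
      obtain ⟨c, rfl⟩ := Polynomial.natDegree_eq_zero.1 h0
      have h1 := hR.2
      have h2 := hR.1.ne_zero
      simp_all
    have hprim : R.IsPrimitive := hR.1.isPrimitive hdeg
    obtain ⟨_⟩ : Nonempty (NormalizedGCDMonoid F[X]) := inferInstance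
    have hirr := (hprim.irreducible_iff_irreducible_map_fraction_map (K := RatFunc F)).1 hR.1
    exact ⟨hprim, ((minpoly.irreducible hint).associated_of_dvd hirr
      (minpoly.dvd _ _ hR.2)).symm⟩
  obtain ⟨_⟩ : Nonempty (NormalizedGCDMonoid F[X]) := inferInstance
  exact hP.1.associated_of_dvd hQ.1 <|
    Polynomial.IsPrimitive.dvd_of_fraction_map_dvd_fraction_map (K := RatFunc F)
      (key hP).1 (((key hP).2.trans (key hQ).2.symm).dvd)

theorem polyHeight_eq_of_associated {P Q : F[X][X]} (h : Associated P Q) :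
    polyHeight P = polyHeight Q := by
  obtain ⟨u, rfl⟩ := h
  obtain ⟨r, hr, hu⟩ := Polynomial.isUnit_iff.1 u.isUnit
  obtain ⟨c, hc, rfl⟩ := Polynomial.isUnit_iff.1 hr
  have hc0 : c ≠ 0 := hc.ne_zero
  have h1 : ∀ i, (P * (u : F[X][X])).coeff i = P.coeff i * C c := by
    intro i; rw [← hu, Polynomial.coeff_mul_C]
  unfold polyHeight
  have h2 : (P * (u : F[X][X])).support = P.support := by
    ext i; simp [h1, hc0]
  rw [h2]
  refine Finset.sup_congr rfl fun i _ => ?_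
  rw [h1, Polynomial.natDegree_mul_C hc0]

theorem exists_isMinpoly [FiniteDimensional (RatFunc F) K] (α : K) :
    ∃ P : F[X][X], IsMinpoly α P := by
  obtain ⟨p, hp0, hp⟩ : IsAlgebraic (RatFunc F) α := Algebra.IsAlgebraic.isAlgebraic α
  set N := IsLocalization.integerNormalization (nonZeroDivisors F[X]) p with hN
  have hN0 : N ≠ 0 := fun h => hp0 (IsFractionRing.integerNormalization_eq_zero_iff.1 h)
  let φ : F[X][X] →+* K := eval₂RingHom
    ((algebraMap (RatFunc F) K).comp (algebraMap F[X] (RatFunc F))) α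
  have hφ : ∀ P : F[X][X], φ P = aeval α (P.map (algebraMap F[X] (RatFunc F))) := by
    intro P
    rw [Polynomial.aeval_def, Polynomial.eval₂_map]
    rfl
  have hNφ : φ N = 0 :=
    IsLocalization.integerNormalization_eval₂_eq_zero (nonZeroDivisors F[X]) _ p hp
  obtain ⟨s, hs, hsN⟩ := WfDvdMonoid.exists_factors N hN0
  have hprod : (s.map φ).prod = 0 := by
    obtain ⟨w, hw⟩ := hsN
    rw [← hw, map_mul] at hNφ
    have hwu : φ (w : F[X][X]) ≠ 0 := (w.isUnit.map φ).ne_zero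
    rw [← map_multiset_prod]
    exact (mul_eq_zero.1 hNφ).resolve_right hwu
  obtain ⟨P, hPs, hP0⟩ := Multiset.mem_map.1 (Multiset.prod_eq_zero_iff.1 hprod)
  exact ⟨P, hs P hPs, (hφ P).symm.trans hP0⟩

variable (F) in
/-- The height of an element `α` of a finite extension `K` of `F(T)`: the height of its
minimal polynomial over `F[T]`. -/
noncomputable def height [FiniteDimensional (RatFunc F) K] (α : K) : ℕ :=
  polyHeight (exists_isMinpoly (F := F) α).choose

theorem height_eq [FiniteDimensional (RatFunc F) K] {α : K} {P : F[X][X]}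
    (hP : IsMinpoly α P) : height F α = polyHeight P :=
  polyHeight_eq_of_associated ((exists_isMinpoly (F := F) α).choose_spec.associated hP)

end FunctionFieldHeight

/-! Valuations turn the problem into one about integer vectors of bounded weighted `ℓ¹`-norm. Take
the finite places of `K` over `F[T]` together with those over `F[1/T]`. A nonzero element of height
at most `h` and its inverse have a common denominator of degree at most `2h` with respect to either
ring, so the sum of `deg * |ord|` over all places is `O(h)`. Multiplication adds valuation vectors.
Two elements with the same vector have a quotient integral over both rings; the minimal polynomial
of that quotient has coefficients in `F[T] ∩ F[1/T] = F`, so each vector belongs to boundedly many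
elements (`card_integral_le`).

For vectors, a weighted discrete Prékopa–Leindler inequality on `ℤ` tensorizes over the coordinates
(`weighted_card_mul_le`): the product of the weighted sizes of `A` and `B` is at most a constant
times `#(A * B)`. What is lost is the square of the reciprocal of the least weight of an element.
The weight `16 ^ (-|t|)` costs nothing at a zero coordinate, so the number of places does not
matter; used at places of degree above `m`, it loses at most `16 ^ (O(h) / (m + 1))`. The `O(q ^ (m
+ 1))` remaining places get the uniform weight on an interval of radius `M = O(h)`, losing a factor
`2 * M + 1` each. Choosing `q ^ m` close to `√h` bounds the total loss by `exp (O(h / log h))` for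
large `h`, which is better than required.

Denominator bounds, unlike minimal polynomials, pass to products at once, so (ii) follows by
iterating the bound for two sets. Removing zero from a set costs at most a factor 2. -/

namespace ProductSet

/-! ### Weights on the integers with a discrete Prékopa–Leindler inequality. -/

open Finset

/-- A weight `w` on an abelian group for which a discrete Prékopa–Leindler inequality with
weights holds. -/
def AdmissibleWeight {Γ : Type*} [AddCommGroup Γ] [DecidableEq Γ] (w : Γ → ℝ) : Prop :=
  (∀ t, 0 ≤ w t) ∧ ∀ (S T : Finset Γ) (f g m : Γ → ℝ), (∀ t, 0 ≤ f t) → (∀ t, 0 ≤ g t) →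
    (∀ t, 0 ≤ m t) → (∀ a ∈ S, ∀ b ∈ T, f a * g b ≤ m (a + b)) →
    (∑ a ∈ S, f a * w a) * (∑ b ∈ T, g b * w b) ≤ ∑ t ∈ S + T, m t

/-- Each `f a * g b` is at most the whole sum of `m`, and the weights `w a * w b` have total mass at
most 1. -/
theorem admissibleWeight_of_sum_le_one {Γ : Type*} [AddCommGroup Γ] [DecidableEq Γ] {w : Γ → ℝ}
    (hw : ∀ t, 0 ≤ w t) (hsum : ∀ S : Finset Γ, ∑ t ∈ S, w t ≤ 1) : AdmissibleWeight w := by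
  refine ⟨hw, fun S T f g m hf hg hm hfg => ?_⟩
  have hle : ∀ a ∈ S, ∀ b ∈ T, f a * g b ≤ ∑ t ∈ S + T, m t := fun a ha b hb =>
    (hfg a ha b hb).trans
      (single_le_sum (f := m) (fun t _ => hm t) (add_mem_add ha hb))
  have hQ : 0 ≤ ∑ t ∈ S + T, m t := sum_nonneg fun t _ => hm t
  calc (∑ a ∈ S, f a * w a) * (∑ b ∈ T, g b * w b)
      = ∑ a ∈ S, ∑ b ∈ T, (f a * g b) * (w a * w b) := by
        rw [sum_mul_sum]
        exact sum_congr rfl fun a _ => sum_congr rfl fun b _ => by ring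
    _ ≤ ∑ a ∈ S, ∑ b ∈ T, (∑ t ∈ S + T, m t) * (w a * w b) :=
        sum_le_sum fun a ha => sum_le_sum fun b hb =>
          mul_le_mul_of_nonneg_right (hle a ha b hb) (mul_nonneg (hw a) (hw b))
    _ = (∑ t ∈ S + T, m t) * ((∑ a ∈ S, w a) * ∑ b ∈ T, w b) := by
        rw [sum_mul_sum, mul_sum]
        exact sum_congr rfl fun a _ => by rw [mul_sum]
    _ ≤ (∑ t ∈ S + T, m t) * 1 :=
        mul_le_mul_of_nonneg_left
          (mul_le_one₀ (hsum S) (sum_nonneg fun b _ => hw b) (hsum T)) hQ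
    _ = _ := mul_one _

theorem le_half_add_of_mul_le {x y p q : ℝ} (hx : 0 ≤ x) (hp : 0 ≤ p) (hq : 0 ≤ q)
    (hxy : x ≤ y) (h : x * y ≤ p * q) : x ≤ (p + q) / 2 := by
  nlinarith [sq_nonneg (p - q), mul_le_mul_of_nonneg_left hxy hx]

/-- Contribution of the pairs with non-zero sum. -/
theorem sum_filter_ne_zero_le {w : ℤ → ℝ} (hw : ∀ t, 0 ≤ w t) (hw1 : ∀ t, w t ≤ 1)
    (hsum : ∀ S : Finset ℤ, 0 ∉ S → ∑ t ∈ S, w t ≤ 1 / 4)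
    {S T : Finset ℤ} {f g m : ℤ → ℝ} (hm : ∀ t, 0 ≤ m t)
    (hfg : ∀ a ∈ S, ∀ b ∈ T, f a * g b ≤ m (a + b)) :
    ∑ x ∈ (S ×ˢ T) with x.1 + x.2 ≠ 0, (f x.1 * w x.1) * (g x.2 * w x.2) ≤
      (1 / 2) * ∑ t ∈ (S + T).erase 0, m t := by
  have hmaps : ∀ x ∈ (S ×ˢ T).filter (fun x => x.1 + x.2 ≠ 0),
      x.1 + x.2 ∈ (S + T).erase 0 := by
    intro x hx
    obtain ⟨hx, hne⟩ := mem_filter.1 hx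
    obtain ⟨h1, h2⟩ := mem_product.1 hx
    exact mem_erase.2 ⟨hne, add_mem_add h1 h2⟩
  rw [← sum_fiberwise_of_maps_to hmaps, mul_sum]
  refine sum_le_sum fun t ht => ?_
  have ht0 : t ≠ 0 := (mem_erase.1 ht).1
  set P := ((S ×ˢ T).filter (fun x => x.1 + x.2 ≠ 0)).filter (fun x => x.1 + x.2 = t) with hP
  have hPmem : ∀ x ∈ P, x.1 ∈ S ∧ x.2 ∈ T ∧ x.1 + x.2 = t := by
    intro x hx
    rw [hP, mem_filter, mem_filter, mem_product] at hx
    exact ⟨hx.1.1.1, hx.1.1.2, hx.2⟩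
  have hinj1 : Set.InjOn Prod.fst (P : Set (ℤ × ℤ)) := by
    intro x hx y hy hxy
    have h1 := (hPmem x hx).2.2
    have h2 := (hPmem y hy).2.2
    exact Prod.ext hxy (by omega)
  have hinj2 : Set.InjOn Prod.snd (P : Set (ℤ × ℤ)) := by
    intro x hx y hy hxy
    have h1 := (hPmem x hx).2.2
    have h2 := (hPmem y hy).2.2
    exact Prod.ext (by omega) hxy
  -- As `t ≠ 0`, every pair has a nonzero coordinate. Keep only the weight of such a coordinate;
  -- both projections are injective on `P`, so each of the two groups contributes at most 1/4.
  have hw2 : ∑ x ∈ P, w x.1 * w x.2 ≤ 1 / 2 := by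
    have h1 : ∑ x ∈ P with x.1 ≠ 0, w x.1 ≤ 1 / 4 := by
      rw [← sum_image (f := w) (g := Prod.fst) (hinj1.mono (coe_subset.2 (filter_subset _ _)))]
      exact hsum _ (by simp)
    have h2 : ∑ x ∈ P with ¬ x.1 ≠ 0, w x.2 ≤ 1 / 4 := by
      rw [← sum_image (f := w) (g := Prod.snd) (hinj2.mono (coe_subset.2 (filter_subset _ _)))]
      refine hsum _ fun h0 => ?_
      obtain ⟨x, hx, hx0⟩ := mem_image.1 h0
      obtain ⟨hxP, hx1⟩ := mem_filter.1 hx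
      have := (hPmem x hxP).2.2
      omega
    rw [← sum_filter_add_sum_filter_not P (fun x => x.1 ≠ 0)]
    have h3 : ∑ x ∈ P with x.1 ≠ 0, w x.1 * w x.2 ≤ ∑ x ∈ P with x.1 ≠ 0, w x.1 :=
      sum_le_sum fun x _ => mul_le_of_le_one_right (hw _) (hw1 _)
    have h4 : ∑ x ∈ P with ¬ x.1 ≠ 0, w x.1 * w x.2 ≤ ∑ x ∈ P with ¬ x.1 ≠ 0, w x.2 :=
      sum_le_sum fun x _ => mul_le_of_le_one_left (hw _) (hw1 _)
    linarith
  calc ∑ x ∈ P, (f x.1 * w x.1) * (g x.2 * w x.2)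
      ≤ ∑ x ∈ P, m t * (w x.1 * w x.2) := by
        refine sum_le_sum fun x hx => ?_
        obtain ⟨h1, h2, h3⟩ := hPmem x hx
        have := hfg _ h1 _ h2
        rw [h3] at this
        calc _ = (f x.1 * g x.2) * (w x.1 * w x.2) := by ring
          _ ≤ _ := mul_le_mul_of_nonneg_right this (mul_nonneg (hw _) (hw _))
    _ = m t * ∑ x ∈ P, w x.1 * w x.2 := by rw [mul_sum]
    _ ≤ m t * (1 / 2) := mul_le_mul_of_nonneg_left hw2 (hm t)
    _ = 1 / 2 * m t := mul_comm _ _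

/-- Contribution of the pairs with zero sum. -/
theorem sum_antidiagonal_zero_le {w : ℤ → ℝ} (hw : ∀ t, 0 ≤ w t) (hw1 : ∀ t, w t ≤ 1)
    (hsum : ∀ S : Finset ℤ, 0 ∉ S → ∑ t ∈ S, w t ≤ 1 / 4)
    {S T D : Finset ℤ} {f g m : ℤ → ℝ} (hf : ∀ t, 0 ≤ f t) (hg : ∀ t, 0 ≤ g t)
    (hm : ∀ t, 0 ≤ m t)
    (hfg : ∀ a ∈ S, ∀ b ∈ T, f a * g b ≤ m (a + b)) (hD : ∀ a ∈ D, a ∈ S ∧ -a ∈ T)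
    (hne : D.Nonempty) :
    ∑ a ∈ D, (f a * w a) * (g (-a) * w (-a)) ≤
      m 0 + (1 / 2) * ∑ t ∈ (S + T).erase 0, m t := by
  set Q := ∑ t ∈ (S + T).erase 0, m t with hQ
  have hQ0 : 0 ≤ Q := sum_nonneg fun t _ => hm t
  set x : ℤ → ℝ := fun a => f a * g (-a) with hx
  have hx0 : ∀ a, 0 ≤ x a := fun a => mul_nonneg (hf _) (hg _)
  have hxm : ∀ a ∈ D, x a ≤ m 0 := fun a ha => by
    simpa using hfg a (hD a ha).1 (-a) (hD a ha).2
  obtain ⟨c, hc, hmax⟩ := exists_max_image D x hne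
  -- Swapping partners between `(a, -a)` and `(c, -c)` gives sums `a - c` and `c - a`, which are
  -- distinct and nonzero; so `x a * x c` is at most the product of two different terms of `Q`.
  -- Maximality of `x c` and AM-GM then bound `x a`.
  have hxQ : ∀ a ∈ D, a ≠ c → x a ≤ Q / 2 := by
    intro a ha hac
    have h1 := hfg a (hD a ha).1 (-c) (hD c hc).2
    have h2 := hfg c (hD c hc).1 (-a) (hD a ha).2
    have h3 : x a * x c ≤ m (a + -c) * m (c + -a) := by
      calc x a * x c = (f a * g (-c)) * (f c * g (-a)) := by simp only [hx]; ring
        _ ≤ _ := mul_le_mul h1 h2 (mul_nonneg (hf _) (hg _)) (hm _)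
    have h4 : m (a + -c) + m (c + -a) ≤ Q := by
      have hne' : a + -c ≠ c + -a := by omega
      rw [← sum_pair hne', hQ]
      refine sum_le_sum_of_subset_of_nonneg ?_ fun t _ _ => hm t
      intro t ht
      rcases mem_insert.1 ht with rfl | ht
      · exact mem_erase.2 ⟨by omega, add_mem_add (hD a ha).1 (hD c hc).2⟩
      · rw [mem_singleton.1 ht]
        exact mem_erase.2 ⟨by omega, add_mem_add (hD c hc).1 (hD a ha).2⟩
    have := le_half_add_of_mul_le (hx0 a) (hm _) (hm _) (hmax a ha) h3
    linarith
  have hrest : ∀ E : Finset ℤ, E ⊆ D → c ∉ E → 0 ∉ E →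
      ∑ a ∈ E, w a * w (-a) * x a ≤ Q / 8 := by
    intro E hE hcE h0E
    calc ∑ a ∈ E, w a * w (-a) * x a ≤ ∑ a ∈ E, w a * (Q / 2) := by
          refine sum_le_sum fun a ha => ?_
          refine mul_le_mul (mul_le_of_le_one_right (hw _) (hw1 _))
            (hxQ a (hE ha) fun h => hcE (h ▸ ha)) (hx0 a) (hw a)
      _ = (∑ a ∈ E, w a) * (Q / 2) := by rw [sum_mul]
      _ ≤ (1 / 4) * (Q / 2) := mul_le_mul_of_nonneg_right (hsum E h0E) (by linarith)
      _ = Q / 8 := by ring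
  have hrw : ∑ a ∈ D, (f a * w a) * (g (-a) * w (-a)) = ∑ a ∈ D, w a * w (-a) * x a :=
    sum_congr rfl fun a _ => by simp only [hx]; ring
  have hm0 := hm 0
  rw [hrw, ← add_sum_erase D _ hc]
  have hcm := hxm c hc
  have hwc1 : w c * w (-c) ≤ 1 := mul_le_one₀ (hw1 _) (hw _) (hw1 _)
  -- The index 0 may have weight 1 without being the maximizer. Then `c ≠ 0` carries weight at most
  -- 1/4 and uses a quarter of `m 0`; `x 0`, bounded by both `m 0` and `Q / 2`, takes the other
  -- three quarters plus `Q / 8`.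
  by_cases h0 : (0 : ℤ) ∈ D.erase c
  · obtain ⟨h0c, h0D⟩ := mem_erase.1 h0
    rw [← add_sum_erase _ _ h0]
    have h1 := hrest ((D.erase c).erase 0)
      ((erase_subset _ _).trans (erase_subset _ _)) (by simp) (by simp)
    have hwc : w c * w (-c) ≤ 1 / 4 := by
      have : w c ≤ 1 / 4 := by simpa using hsum {c} (by simpa using h0c)
      exact (mul_le_of_le_one_right (hw _) (hw1 _)).trans this
    have h2 : w 0 * w (-0) * x 0 ≤ x 0 :=
      mul_le_of_le_one_left (hx0 0) (mul_le_one₀ (hw1 _) (hw _) (hw1 _))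
    have h3 := hxQ 0 h0D h0c
    have h4 := hxm 0 h0D
    have h5 : w c * w (-c) * x c ≤ 1 / 4 * m 0 :=
      mul_le_mul hwc hcm (hx0 c) (by norm_num)
    rw [neg_zero] at h2 ⊢
    linarith
  · have h1 := hrest (D.erase c) (erase_subset _ _) (by simp) h0
    have h2 : w c * w (-c) * x c ≤ x c := mul_le_of_le_one_left (hx0 c) hwc1
    linarith

/-- The total mass may exceed 1: a full weight at 0 is affordable if little mass lies elsewhere.
Pairs with nonzero sum use half of the sum of `m` off 0, and pairs with zero sum use `m 0` and the
other half. -/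
theorem admissibleWeight_of_sum_ne_zero_le {w : ℤ → ℝ} (hw : ∀ t, 0 ≤ w t) (hw0 : w 0 ≤ 1)
    (hsum : ∀ S : Finset ℤ, 0 ∉ S → ∑ t ∈ S, w t ≤ 1 / 4) : AdmissibleWeight w := by
  refine ⟨hw, fun S T f g m hf hg hm hfg => ?_⟩
  have hw1 : ∀ t, w t ≤ 1 := by
    intro t
    by_cases ht : t = 0
    · rwa [ht]
    · have : w t ≤ 1 / 4 := by simpa using hsum {t} (by simpa using Ne.symm ht)
      linarith
  have hQ0 : 0 ≤ ∑ t ∈ (S + T).erase 0, m t := sum_nonneg fun t _ => hm t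
  have h1 := sum_filter_ne_zero_le hw hw1 hsum hm hfg
  rw [sum_mul_sum, ← sum_product', ← sum_filter_not_add_sum_filter _ (fun x => x.1 + x.2 ≠ 0)]
  set D := S.filter (fun a => -a ∈ T) with hD
  have hDeq : ∑ x ∈ S ×ˢ T with ¬ x.1 + x.2 ≠ 0, (f x.1 * w x.1) * (g x.2 * w x.2) =
      ∑ a ∈ D, (f a * w a) * (g (-a) * w (-a)) := by
    refine sum_bij' (fun x _ => x.1) (fun a _ => (a, -a)) ?_ ?_ ?_ ?_ ?_
    · intro x hx
      rw [mem_filter, mem_product] at hx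
      have : x.2 = -x.1 := by omega
      exact mem_filter.2 ⟨hx.1.1, this ▸ hx.1.2⟩
    · intro a ha
      rw [mem_filter] at ha
      simp [ha.1, ha.2]
    · intro x hx
      rw [mem_filter] at hx
      exact Prod.ext rfl (by simp only; omega)
    · intro a _; rfl
    · intro x hx
      rw [mem_filter] at hx
      have : x.2 = -x.1 := by omega
      simp [this]
  rw [hDeq]
  rcases D.eq_empty_or_nonempty with hDe | hDne
  · rw [hDe, sum_empty]
    have : ∑ t ∈ (S + T).erase 0, m t ≤ ∑ t ∈ S + T, m t :=
      sum_le_sum_of_subset_of_nonneg (erase_subset _ _) fun t _ _ => hm t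
    linarith
  · have hDm : ∀ a ∈ D, a ∈ S ∧ -a ∈ T := fun a ha => mem_filter.1 ha
    have h2 := sum_antidiagonal_zero_le hw hw1 hsum hf hg hm hfg hDm hDne
    obtain ⟨a, ha⟩ := hDne
    have h0 : (0 : ℤ) ∈ S + T := by
      simpa using add_mem_add (hDm a ha).1 (hDm a ha).2
    rw [← add_sum_erase _ _ h0]
    linarith

theorem sum_pow_natAbs_le (S : Finset ℤ) (hS : (0 : ℤ) ∉ S) :
    ∑ t ∈ S, (1 / 16 : ℝ) ^ t.natAbs ≤ 1 / 4 := by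
  have hgeo : ∀ U : Finset ℕ, 0 ∉ U → ∑ n ∈ U, (1 / 16 : ℝ) ^ n ≤ 1 / 8 := by
    intro U hU
    -- Adding the term 1 at index 0 allows comparison with the full series `16 / 15`, leaving `1 /
    -- 15 ≤ 1 / 8` for each sign.
    have h1 := (summable_geometric_of_lt_one (r := (1 / 16 : ℝ)) (by norm_num)
      (by norm_num)).sum_le_tsum (insert 0 U) (fun n _ => by positivity)
    rw [sum_insert hU, tsum_geometric_of_lt_one (by norm_num) (by norm_num)] at h1
    norm_num at h1 ⊢
    linarith
  rw [← sum_filter_add_sum_filter_not S (fun t => 0 < t)]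
  have key : ∀ P : Finset ℤ, 0 ∉ P → Set.InjOn Int.natAbs (P : Set ℤ) →
      ∑ t ∈ P, (1 / 16 : ℝ) ^ t.natAbs ≤ 1 / 8 := by
    intro P hP0 hinj
    rw [← sum_image (f := fun n => (1 / 16 : ℝ) ^ n) hinj]
    exact hgeo _ (by simpa using hP0)
  have h1 := key (S.filter (fun t => 0 < t)) (by simp) (by
    intro x hx y hy hxy
    simp at hx hy
    omega)
  have h2 := key (S.filter (fun t => ¬ 0 < t)) (by simp [hS]) (by
    intro x hx y hy hxy
    simp at hx hy
    omega)
  linarith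

theorem admissibleWeight_pow : AdmissibleWeight (fun t : ℤ => (1 / 16 : ℝ) ^ t.natAbs) :=
  admissibleWeight_of_sum_ne_zero_le (fun _ => by positivity) (by simp) sum_pow_natAbs_le

theorem admissibleWeight_interval (M : ℕ) :
    AdmissibleWeight (fun t : ℤ => if t.natAbs ≤ M then (1 / (2 * M + 1) : ℝ) else 0) := by
  refine admissibleWeight_of_sum_le_one (fun t => by split_ifs <;> positivity) fun S => ?_
  rw [← sum_filter, sum_const, nsmul_eq_mul]
  have hsub : S.filter (fun t => t.natAbs ≤ M) ⊆ Icc (-(M : ℤ)) M := by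
    intro t ht
    rw [mem_filter] at ht
    rw [mem_Icc]
    omega
  have hcard : #(S.filter (fun t => t.natAbs ≤ M)) ≤ 2 * M + 1 := by
    refine (card_le_card hsub).trans ?_
    rw [Int.card_Icc]
    omega
  rw [mul_one_div, div_le_one (by positivity)]
  exact_mod_cast hcard

/-! ### Tensorization over the coordinates. -/

/-- Tensorization: if the joint fibres of `φ i`, `i ∈ s`, on `A` and `B` have at most `R`
elements, then the weighted sizes of `A` and `B` bound the size of `A * B`. -/
theorem weighted_card_mul_le {G ι : Type*} [Mul G] [DecidableEq G] [DecidableEq ι]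
    {R : ℕ} (φ : ι → G → ℤ)
    (w : ι → ℤ → ℝ) (hw : ∀ i, AdmissibleWeight (w i)) (s : Finset ι) :
    ∀ A B : Finset G, (∀ i, ∀ x ∈ A, ∀ y ∈ B, φ i (x * y) = φ i x + φ i y) →
      (∀ x ∈ A, #{y ∈ A | ∀ i ∈ s, φ i y = φ i x} ≤ R) →
      (∀ x ∈ B, #{y ∈ B | ∀ i ∈ s, φ i y = φ i x} ≤ R) →
      (∑ a ∈ A, ∏ i ∈ s, w i (φ i a)) * (∑ b ∈ B, ∏ i ∈ s, w i (φ i b)) ≤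
        (R : ℝ) ^ 2 * #(A * B) := by
  induction s using Finset.induction_on with
  | empty =>
    intro A B hφ hA hB
    rcases A.eq_empty_or_nonempty with rfl | ⟨x, hx⟩
    · simp
    rcases B.eq_empty_or_nonempty with rfl | ⟨y, hy⟩
    · simp
    have h1 : (#A : ℝ) ≤ R := by exact_mod_cast (by simpa using hA x hx : #A ≤ R)
    have h2 : (#B : ℝ) ≤ R := by exact_mod_cast (by simpa using hB y hy : #B ≤ R)
    have h3 : (1 : ℝ) ≤ #(A * B) := by
      exact_mod_cast (card_pos.2 ⟨x * y, mul_mem_mul hx hy⟩ : 0 < #(A * B))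
    have h4 : (#A : ℝ) * #B ≤ R * R := mul_le_mul h1 h2 (by positivity) (by positivity)
    simp only [prod_empty, sum_const, nsmul_eq_mul, mul_one]
    nlinarith [sq_nonneg (R : ℝ)]
  | insert j s hj ih =>
    intro A B hφ hA hB
    have hfib : ∀ (C : Finset G), (∀ x ∈ C, #{y ∈ C | ∀ i ∈ insert j s, φ i y = φ i x} ≤ R) →
        ∀ t, ∀ x ∈ C.filter (fun a => φ j a = t),
          #{y ∈ C.filter (fun a => φ j a = t) | ∀ i ∈ s, φ i y = φ i x} ≤ R := by
      intro C hC t x hx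
      rw [mem_filter] at hx
      refine (card_le_card ?_).trans (hC x hx.1)
      intro y hy
      rw [mem_filter, mem_filter] at hy
      refine mem_filter.2 ⟨hy.1.1, fun i hi => ?_⟩
      rcases mem_insert.1 hi with rfl | hi
      · rw [hy.1.2, hx.2]
      · exact hy.2 i hi
    have hsplit : ∀ C : Finset G, ∑ a ∈ C, ∏ i ∈ insert j s, w i (φ i a) =
        ∑ t ∈ C.image (φ j), (∑ a ∈ C with φ j a = t, ∏ i ∈ s, w i (φ i a)) * w j t := by
      intro C
      rw [← sum_fiberwise_of_maps_to (fun a ha => mem_image_of_mem (φ j) ha)]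
      refine sum_congr rfl fun t _ => ?_
      rw [sum_mul]
      refine sum_congr rfl fun a ha => ?_
      rw [prod_insert hj, (mem_filter.1 ha).2, mul_comm]
    have hnn : ∀ (C : Finset G) t, 0 ≤ ∑ a ∈ C with φ j a = t, ∏ i ∈ s, w i (φ i a) :=
      fun C t => sum_nonneg fun a _ => prod_nonneg fun i _ => (hw i).1 _
    rw [hsplit A, hsplit B]
    -- The weighted sizes of the fibres of `A` and `B` over `φ j` play `f` and `g`; `R ^ 2` times
    -- the fibre sizes of `A * B` plays `m`. The induction hypothesis on fibres is the required
    -- pointwise inequality.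
    refine ((hw j).2 _ _ _ _ (fun t => (R : ℝ) ^ 2 * #{x ∈ A * B | φ j x = t})
      (hnn A) (hnn B) (fun t => by positivity) ?_).trans ?_
    · intro a _ b _
      refine (ih _ _ (fun i x hx y hy => hφ i x (mem_filter.1 hx).1 y (mem_filter.1 hy).1)
        (hfib A hA a) (hfib B hB b)).trans ?_
      refine mul_le_mul_of_nonneg_left ?_ (by positivity)
      refine Nat.cast_le.2 (card_le_card ?_)
      intro z hz
      obtain ⟨x, hx, y, hy, rfl⟩ := mem_mul.1 hz
      rw [mem_filter] at hx hy
      exact mem_filter.2 ⟨mul_mem_mul hx.1 hy.1, by rw [hφ j x hx.1 y hy.1, hx.2, hy.2]⟩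
    · rw [← mul_sum]
      refine mul_le_mul_of_nonneg_left (le_of_eq ?_) (by positivity)
      rw [← Nat.cast_sum, ← card_eq_sum_card_fiberwise]
      intro z hz
      obtain ⟨x, hx, y, hy, rfl⟩ := mem_mul.1 (mem_coe.1 hz)
      rw [mem_coe, hφ j x hx y hy]
      exact add_mem_add (mem_image_of_mem _ hx) (mem_image_of_mem _ hy)

/-- Weights are multiplied over a finite index set while `ι` may be infinite; one index for each
pair with different values suffices. -/
theorem exists_finset_separating {G ι : Type*} [DecidableEq ι] (φ : ι → G → ℤ) (C : Finset G) :
    ∃ s : Finset ι, ∀ x ∈ C, ∀ y ∈ C, (∀ i ∈ s, φ i y = φ i x) → ∀ i, φ i y = φ i x := by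
  classical
  have h : ∀ z : G × G, ∃ s : Finset ι, (∀ i ∈ s, φ i z.2 = φ i z.1) →
      ∀ i, φ i z.2 = φ i z.1 := by
    intro z
    by_cases hz : ∀ i, φ i z.2 = φ i z.1
    · exact ⟨∅, fun _ => hz⟩
    · push Not at hz
      obtain ⟨i, hi⟩ := hz
      exact ⟨{i}, fun hs => absurd (hs i (mem_singleton_self i)) hi⟩
  choose s hs using h
  refine ⟨(C ×ˢ C).biUnion s, fun x hx y hy hxy => hs (x, y) fun i hi => hxy i ?_⟩
  exact mem_biUnion.2 ⟨(x, y), mem_product.2 ⟨hx, hy⟩, hi⟩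

/-- Lower bound for the size of `A * B` when the elements of `A` and `B` have weighted
`ℓ¹`-norm at most `M` with respect to additive functions `φ i`. -/
theorem card_mul_card_le {G ι : Type*} [Mul G] [DecidableEq G] (φ : ι → G → ℤ) (deg : ι → ℕ)
    {R M c m : ℕ} {A B : Finset G}
    (hφ : ∀ i, ∀ x ∈ A, ∀ y ∈ B, φ i (x * y) = φ i x + φ i y)
    (hfib : ∀ C : Finset G, C ⊆ A ∪ B → ∀ x ∈ C, (∀ y ∈ C, ∀ i, φ i y = φ i x) → #C ≤ R)
    (hdeg : ∀ i, 1 ≤ deg i)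
    (hsum : ∀ x ∈ A ∪ B, ∀ s : Finset ι, ∑ i ∈ s, deg i * (φ i x).natAbs ≤ M)
    (hcard : ∀ s : Finset ι, (∀ i ∈ s, deg i ≤ m) → #s ≤ c) :
    (#A : ℝ) * #B ≤
      R ^ 2 * ((2 * M + 1 : ℝ) ^ c * 16 ^ (M / (m + 1))) ^ 2 * #(A * B) := by
  classical
  obtain ⟨s, hs⟩ := exists_finset_separating φ (A ∪ B)
  -- The few indices of degree at most `m` get a uniform weight; all others get the weight that is
  -- free at 0.
  set w : ι → ℤ → ℝ := fun i => if deg i ≤ m then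
    (fun t : ℤ => if t.natAbs ≤ M then (1 / (2 * M + 1) : ℝ) else 0)
    else (fun t : ℤ => (1 / 16 : ℝ) ^ t.natAbs) with hw
  have hadm : ∀ i, AdmissibleWeight (w i) := by
    intro i
    simp only [hw]
    split_ifs
    · exact admissibleWeight_interval M
    · exact admissibleWeight_pow
  set E : ℝ := (2 * M + 1 : ℝ) ^ c * 16 ^ (M / (m + 1)) with hE
  have hE0 : 0 < E := by positivity
  have hlow : ∀ x ∈ A ∪ B, E⁻¹ ≤ ∏ i ∈ s, w i (φ i x) := by
    intro x hx
    have hM := hsum x hx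
    rw [← prod_filter_mul_prod_filter_not s (fun i => deg i ≤ m), hE, mul_inv]
    refine mul_le_mul ?_ ?_ (by positivity) (prod_nonneg fun i _ => (hadm i).1 _)
    · have h1 : ∏ i ∈ s with deg i ≤ m, w i (φ i x) =
          ((2 * M + 1 : ℝ)⁻¹) ^ #{i ∈ s | deg i ≤ m} := by
        rw [← prod_const]
        refine prod_congr rfl fun i hi => ?_
        have hi2 := (mem_filter.1 hi).2
        have h2 : (φ i x).natAbs ≤ M := by
          have := hM {i}
          rw [sum_singleton] at this
          exact (Nat.le_mul_of_pos_left _ (hdeg i)).trans this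
        simp [hw, hi2, h2]
      rw [h1, ← inv_pow]
      refine pow_le_pow_of_le_one (by positivity) (inv_le_one_of_one_le₀ ?_)
        (hcard _ fun i hi => (mem_filter.1 hi).2)
      have : (0 : ℝ) ≤ M := by positivity
      linarith
    · have h1 : ∏ i ∈ s with ¬ deg i ≤ m, w i (φ i x) =
          (1 / 16 : ℝ) ^ ∑ i ∈ s with ¬ deg i ≤ m, (φ i x).natAbs := by
        rw [← prod_pow_eq_pow_sum]
        refine prod_congr rfl fun i hi => ?_
        simp [hw, (mem_filter.1 hi).2]
      rw [h1, ← inv_pow, ← one_div]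
      refine pow_le_pow_of_le_one (by norm_num) (by norm_num) ?_
      -- The indices left have degree at least `m + 1`, so `m + 1` times the sum of `|φ i x|` is at
      -- most `M`.
      rw [Nat.le_div_iff_mul_le (Nat.succ_pos m), sum_mul]
      refine le_trans (sum_le_sum fun i hi => ?_) (hM {i ∈ s | ¬ deg i ≤ m})
      rw [mul_comm]
      exact Nat.mul_le_mul_right _ (by have := (mem_filter.1 hi).2; omega)
  have hfib' : ∀ C : Finset G, C ⊆ A ∪ B →
      ∀ x ∈ C, #{y ∈ C | ∀ i ∈ s, φ i y = φ i x} ≤ R := by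
    intro C hC x hx
    refine hfib _ ((filter_subset _ _).trans hC) x (mem_filter.2 ⟨hx, fun _ _ => rfl⟩) ?_
    intro y hy
    obtain ⟨hyC, hyx⟩ := mem_filter.1 hy
    exact hs x (hC hx) y (hC hyC) hyx
  have hmain := weighted_card_mul_le (R := R) φ w hadm s A B hφ
    (hfib' A subset_union_left) (hfib' B subset_union_right)
  have hA : (#A : ℝ) * E⁻¹ ≤ ∑ a ∈ A, ∏ i ∈ s, w i (φ i a) := by
    rw [← nsmul_eq_mul]
    exact card_nsmul_le_sum _ _ _ fun a ha => hlow a (mem_union_left _ ha)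
  have hB : (#B : ℝ) * E⁻¹ ≤ ∑ b ∈ B, ∏ i ∈ s, w i (φ i b) := by
    rw [← nsmul_eq_mul]
    exact card_nsmul_le_sum _ _ _ fun b hb => hlow b (mem_union_right _ hb)
  have hAB : ((#A : ℝ) * E⁻¹) * (#B * E⁻¹) ≤ (R : ℝ) ^ 2 * #(A * B) :=
    (mul_le_mul hA hB (by positivity) ((by positivity : (0 : ℝ) ≤ #A * E⁻¹).trans hA)).trans hmain
  calc (#A : ℝ) * #B = ((#A : ℝ) * E⁻¹) * (#B * E⁻¹) * E ^ 2 := by field_simp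
    _ ≤ (R : ℝ) ^ 2 * #(A * B) * E ^ 2 := mul_le_mul_of_nonneg_right hAB (by positivity)
    _ = _ := by ring

end ProductSet

/-! ### Finite places: degrees, valuations and counting. -/

namespace FunctionFieldHeight

open Polynomial IsDedekindDomain

section Places

variable {F S : Type*} [Field F] [CommRing S] [Algebra F[X] S]

/-- The degree of the prime of `F[X]` below a place `v`. -/
noncomputable def placeDegree (v : HeightOneSpectrum S) : ℕ :=
  (Submodule.IsPrincipal.generator (v.asIdeal.under F[X])).natDegree

theorem under_eq_span_of_mem {v : HeightOneSpectrum S} {p : F[X]} (hp : Irreducible p)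
    (hv : algebraMap F[X] S p ∈ v.asIdeal) : v.asIdeal.under F[X] = Ideal.span {p} := by
  have hmax : (Ideal.span {p}).IsMaximal := PrincipalIdealRing.isMaximal_of_irreducible hp
  have := v.isPrime
  refine (hmax.eq_of_le (Ideal.IsPrime.ne_top inferInstance) ?_).symm
  rw [Ideal.span_singleton_le_iff_mem]
  exact hv

theorem placeDegree_eq_of_mem {v : HeightOneSpectrum S} {p : F[X]} (hp : Irreducible p)
    (hv : algebraMap F[X] S p ∈ v.asIdeal) : placeDegree (F := F) v = p.natDegree := by
  have h : Ideal.span {Submodule.IsPrincipal.generator (v.asIdeal.under F[X])} =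
      Ideal.span {p} := by
    rw [Ideal.span_singleton_generator, under_eq_span_of_mem hp hv]
  exact Polynomial.natDegree_eq_of_degree_eq
    (Polynomial.degree_eq_degree_of_associated (Ideal.span_singleton_eq_span_singleton.1 h))

theorem multiplicity_eq_zero_of_notMem {v : HeightOneSpectrum S} {x : S} (hx : x ∉ v.asIdeal) :
    multiplicity v.asIdeal (Ideal.span {x}) = 0 := by
  refine multiplicity_eq_zero.2 fun h => hx ?_
  exact (Ideal.span_singleton_le_iff_mem _).1 (Ideal.le_of_dvd h)

variable [IsDedekindDomain S]

theorem exists_irreducible_mem [Module.Finite F[X] S] (v : HeightOneSpectrum S) :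
    ∃ p : F[X], Irreducible p ∧ algebraMap F[X] S p ∈ v.asIdeal := by
  have := v.isPrime
  have hne : v.asIdeal.under F[X] ≠ ⊥ := Ideal.under_ne_bot F[X] v.ne_bot
  set g := Submodule.IsPrincipal.generator (v.asIdeal.under F[X]) with hg
  have hgp : Prime g := Submodule.IsPrincipal.prime_generator_of_isPrime _ hne
  exact ⟨g, hgp.irreducible, Submodule.IsPrincipal.generator_mem (v.asIdeal.under F[X])⟩

theorem one_le_placeDegree [Module.Finite F[X] S] (v : HeightOneSpectrum S) :
    1 ≤ placeDegree (F := F) v := by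
  obtain ⟨p, hp, hv⟩ := exists_irreducible_mem (F := F) v
  rw [placeDegree_eq_of_mem hp hv]
  exact hp.natDegree_pos

variable [Module.IsTorsionFree F[X] S]

/-- The multiplicity is the ramification index `e`, inertia degrees are positive, and the `e * f`
above `p` add up to the rank. -/
theorem sum_multiplicity_le_finrank [Module.Finite F[X] S] {p : F[X]} (hp : Irreducible p)
    (s : Finset (HeightOneSpectrum S)) (hs : ∀ v ∈ s, algebraMap F[X] S p ∈ v.asIdeal) :
    ∑ v ∈ s, multiplicity v.asIdeal (Ideal.span {algebraMap F[X] S p}) ≤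
      Module.finrank F[X] S := by
  classical
  have hmax : (Ideal.span {p}).IsMaximal := PrincipalIdealRing.isMaximal_of_irreducible hp
  have hp0 : (Ideal.span {p} : Ideal F[X]) ≠ ⊥ := by
    simpa using hp.ne_zero
  have : Finite ((Ideal.span {p}).primesOver S) := inferInstance
  let := Fintype.ofFinite ((Ideal.span {p}).primesOver S)
  rw [← Ideal.sum_ramification_inertia_eq_finrank (Ideal.span {p}) S]
  have hlies : ∀ v ∈ s, v.asIdeal ∈ (Ideal.span {p}).primesOver S := fun v hv =>
    ⟨v.isPrime, ⟨(under_eq_span_of_mem hp (hs v hv)).symm⟩⟩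
  have hmap : (Ideal.span {p}).map (algebraMap F[X] S) ≠ ⊥ := Ideal.map_ne_bot_of_ne_bot hp0
  calc ∑ v ∈ s, multiplicity v.asIdeal (Ideal.span {algebraMap F[X] S p})
      = ∑ v ∈ s.attach, multiplicity v.1.asIdeal (Ideal.span {algebraMap F[X] S p}) :=
        (Finset.sum_attach s _).symm
    _ ≤ ∑ v ∈ s.attach, v.1.asIdeal.ramificationIdx F[X] * v.1.asIdeal.inertiaDeg F[X] := by
        refine Finset.sum_le_sum fun v _ => ?_
        have h1 := v.1.isPrime
        have h2 : v.1.asIdeal.LiesOver (Ideal.span {p}) := (hlies v.1 v.2).2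
        rw [Ideal.IsDedekindDomain.ramificationIdx_eq_multiplicity (Ideal.span {p}) _ hmap,
          Ideal.map_span, Set.image_singleton]
        exact Nat.le_mul_of_pos_right _ (Ideal.inertiaDeg_pos _ _)
    _ = ∑ q ∈ s.attach.image (fun v => (⟨v.1.asIdeal, hlies v.1 v.2⟩ :
          (Ideal.span {p}).primesOver S)), q.1.ramificationIdx F[X] * q.1.inertiaDeg F[X] := by
        rw [Finset.sum_image]
        intro v _ w _ h
        exact Subtype.ext (HeightOneSpectrum.ext (congrArg Subtype.val h))
    _ ≤ _ := Finset.sum_le_sum_of_subset (Finset.subset_univ _)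

variable {L : Type*} [Field L] [Algebra S L] [IsFractionRing S L]

/-- The additive valuation of `L` attached to a place `v`. -/
noncomputable def placeOrd (v : HeightOneSpectrum S) (x : L) : ℤ :=
  -WithZero.log (v.valuation L x)

theorem placeOrd_mul (v : HeightOneSpectrum S) {x y : L} (hx : x ≠ 0) (hy : y ≠ 0) :
    placeOrd v (x * y) = placeOrd v x + placeOrd v y := by
  rw [placeOrd, map_mul, WithZero.log_mul ((Valuation.ne_zero_iff _).2 hx)
    ((Valuation.ne_zero_iff _).2 hy), placeOrd, placeOrd]
  ring

theorem placeOrd_inv (v : HeightOneSpectrum S) (x : L) :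
    placeOrd v x⁻¹ = -placeOrd v x := by
  simp [placeOrd]

theorem placeOrd_algebraMap (v : HeightOneSpectrum S) {x : S} (hx : x ≠ 0) :
    placeOrd v (algebraMap S L x) = multiplicity v.asIdeal (Ideal.span {x}) := by
  rw [placeOrd, HeightOneSpectrum.valuation_of_algebraMap,
    HeightOneSpectrum.intValuation_eq_exp_neg_multiplicity v hx, WithZero.log_exp, neg_neg]

theorem placeOrd_algebraMap_nonneg (v : HeightOneSpectrum S) {x : S} (hx : x ≠ 0) :
    0 ≤ placeOrd v (algebraMap S L x) := by
  rw [placeOrd_algebraMap v hx]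
  positivity

theorem mem_range_of_placeOrd_eq_zero {x : L} (hx : x ≠ 0)
    (h : ∀ v : HeightOneSpectrum S, placeOrd v x = 0) : x ∈ (algebraMap S L).range := by
  refine HeightOneSpectrum.mem_integers_of_valuation_le_one L x fun v => ?_
  have h1 : WithZero.log (v.valuation L x) = 0 := by
    have := h v
    rw [placeOrd] at this
    omega
  rw [← WithZero.exp_log ((Valuation.ne_zero_iff (v.valuation L)).2 hx), h1, WithZero.exp_zero]

theorem one_le_multiplicity_of_mem {v : HeightOneSpectrum S} {x : S}
    (hx : x ∈ v.asIdeal) : 1 ≤ multiplicity v.asIdeal (Ideal.span {x}) := by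
  rw [Nat.one_le_iff_ne_zero]
  refine multiplicity_ne_zero.2 ?_
  exact Ideal.dvd_iff_le.2 ((Ideal.span_singleton_le_iff_mem _).2 hx)

/-- Both sides are additive in `a`, so prime `a` suffices; there only the places above it
contribute, all with the degree of that prime. -/
theorem sum_placeDegree_mul_placeOrd_le [Module.Finite F[X] S]
    (s : Finset (HeightOneSpectrum S)) (a : F[X]) (ha : a ≠ 0) :
    ∑ v ∈ s, (placeDegree (F := F) v : ℤ) * placeOrd v (algebraMap S L (algebraMap F[X] S a)) ≤
      Module.finrank F[X] S * a.natDegree := by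
  classical
  have hinj : Function.Injective (algebraMap F[X] S) := FaithfulSMul.algebraMap_injective _ _
  have hne : ∀ {a : F[X]}, a ≠ 0 → algebraMap F[X] S a ≠ 0 := fun h =>
    (map_ne_zero_iff _ hinj).2 h
  have hneL : ∀ {a : F[X]}, a ≠ 0 → algebraMap S L (algebraMap F[X] S a) ≠ 0 := fun h =>
    (map_ne_zero_iff _ (IsFractionRing.injective S L)).2 (hne h)
  induction a using UniqueFactorizationMonoid.induction_on_prime with
  | h₁ => exact absurd rfl ha
  | h₂ a hu =>
    refine (Finset.sum_nonpos fun v _ => ?_).trans (by positivity)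
    rw [placeOrd_algebraMap v (hne ha), multiplicity_eq_zero_of_notMem]
    · simp
    · intro h
      exact v.isPrime.ne_top (Ideal.eq_top_of_isUnit_mem _ h (hu.map _))
  | h₃ a p ha0 hp ih =>
    have hpi : Irreducible p := hp.irreducible
    have h1 : ∀ v ∈ s, (placeDegree (F := F) v : ℤ) *
        placeOrd v (algebraMap S L (algebraMap F[X] S (p * a))) =
        (placeDegree (F := F) v : ℤ) * placeOrd v (algebraMap S L (algebraMap F[X] S p)) +
        (placeDegree (F := F) v : ℤ) * placeOrd v (algebraMap S L (algebraMap F[X] S a)) := by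
      intro v _
      rw [map_mul, map_mul, placeOrd_mul v (hneL hp.ne_zero) (hneL ha0), mul_add]
    have h2 : ∑ v ∈ s, (placeDegree (F := F) v : ℤ) *
        placeOrd v (algebraMap S L (algebraMap F[X] S p)) ≤
        Module.finrank F[X] S * p.natDegree := by
      have h3 := sum_multiplicity_le_finrank hpi
        (s.filter (fun v => algebraMap F[X] S p ∈ v.asIdeal))
        (fun v hv => (Finset.mem_filter.1 hv).2)
      have h4 : ∑ v ∈ s, (placeDegree (F := F) v : ℤ) *
          placeOrd v (algebraMap S L (algebraMap F[X] S p)) =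
          ∑ v ∈ s.filter (fun v => algebraMap F[X] S p ∈ v.asIdeal), (p.natDegree : ℤ) *
            (multiplicity v.asIdeal (Ideal.span {algebraMap F[X] S p}) : ℤ) := by
        rw [Finset.sum_filter]
        refine Finset.sum_congr rfl fun v _ => ?_
        rw [placeOrd_algebraMap v (hne hp.ne_zero)]
        split_ifs with h
        · rw [placeDegree_eq_of_mem hpi h]
        · rw [multiplicity_eq_zero_of_notMem h]; simp
      rw [h4, ← Finset.mul_sum, mul_comm]
      exact mul_le_mul_of_nonneg_right (by exact_mod_cast h3) (by positivity)
    rw [Finset.sum_congr rfl h1, Finset.sum_add_distrib,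
      Polynomial.natDegree_mul hp.ne_zero ha0]
    have h5 := ih ha0
    push_cast
    linarith

theorem card_natDegree_le [Fintype F] (m : ℕ) (s : Finset F[X])
    (hs : ∀ p ∈ s, p.natDegree ≤ m) : s.card ≤ Fintype.card F ^ (m + 1) := by
  classical
  have : s.card ≤ (Finset.univ : Finset (Fin (m + 1) → F)).card := by
    refine Finset.card_le_card_of_injOn (fun p i => p.coeff i) (fun _ _ => Finset.mem_univ _) ?_
    intro p hp q hq h
    ext i
    by_cases hi : i < m + 1
    · exact congrFun h ⟨i, hi⟩
    · rw [coeff_eq_zero_of_natDegree_lt ((hs p hp).trans_lt (by omega)),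
        coeff_eq_zero_of_natDegree_lt ((hs q hq).trans_lt (by omega))]
  simpa using this

/-- There are at most `q ^ (m + 1)` polynomials of degree at most `m`, and boundedly many places
above each prime. -/
theorem card_placeDegree_le [Fintype F] [Module.Finite F[X] S] (m : ℕ)
    (s : Finset (HeightOneSpectrum S)) (hs : ∀ v ∈ s, placeDegree (F := F) v ≤ m) :
    s.card ≤ Module.finrank F[X] S * Fintype.card F ^ (m + 1) := by
  classical
  choose P hPi hPv using fun v : HeightOneSpectrum S => exists_irreducible_mem (F := F) v
  have h1 : (s.image P).card ≤ Fintype.card F ^ (m + 1) := by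
    refine card_natDegree_le m _ fun p hp => ?_
    obtain ⟨v, hv, rfl⟩ := Finset.mem_image.1 hp
    rw [← placeDegree_eq_of_mem (hPi v) (hPv v)]
    exact hs v hv
  have h2 : ∀ p ∈ s.image P, (s.filter (fun v => P v = p)).card ≤ Module.finrank F[X] S := by
    intro p hp
    obtain ⟨v, hv, rfl⟩ := Finset.mem_image.1 hp
    have hmem : ∀ w ∈ s.filter (fun w => P w = P v), algebraMap F[X] S (P v) ∈ w.asIdeal := by
      intro w hw
      rw [← (Finset.mem_filter.1 hw).2]
      exact hPv w
    refine le_trans ?_ (sum_multiplicity_le_finrank (hPi v) _ hmem)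
    rw [Finset.card_eq_sum_ones]
    exact Finset.sum_le_sum fun w hw => one_le_multiplicity_of_mem (hmem w hw)
  calc s.card ≤ Module.finrank F[X] S * (s.image P).card :=
        Finset.card_le_mul_card_image s _ h2
    _ ≤ _ := Nat.mul_le_mul_left _ h1

end Places

end FunctionFieldHeight

/-! ### Systems of valuations, including the inseparable case. -/

namespace FunctionFieldHeight

open Polynomial IsDedekindDomain

/-- A family of additive valuations on `L` detecting integrality over `F[X]` along `g`, with
total size of degree `D` and few members of small degree. -/
structure PlaceSystem {F : Type u} [Field F] {L : Type v} [Field L] (g : F[X] →+* L)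
    (D : ℕ) where
  ι : Type v
  ord : ι → L → ℤ
  deg : ι → ℕ
  ord_mul : ∀ i x y, x ≠ 0 → y ≠ 0 → ord i (x * y) = ord i x + ord i y
  isIntegralElem : ∀ x, x ≠ 0 → (∀ i, ord i x = 0) → g.IsIntegralElem x
  one_le_deg : ∀ i, 1 ≤ deg i
  sum_le : ∀ x a, x ≠ 0 → a ≠ 0 → g.IsIntegralElem (g a * x) → g.IsIntegralElem (g a * x⁻¹) →
    ∀ s : Finset ι, ∑ i ∈ s, deg i * (ord i x).natAbs ≤ D * a.natDegree
  card_le : ∀ (m : ℕ) (s : Finset ι), (∀ i ∈ s, deg i ≤ m) → s.card ≤ D * Nat.card F ^ (m + 1)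

/-- Separability makes the integral closure of `F[X]` a finite module, so its height one primes can
serve. A common denominator `a` of `x` and `x⁻¹` forces `|ord x| ≤ ord a` at each place. -/
theorem nonempty_placeSystem_of_isSeparable {F : Type u} [Field F] [Finite F] {L : Type v}
    [Field L] [Algebra (RatFunc F) L] [FiniteDimensional (RatFunc F) L]
    [Algebra.IsSeparable (RatFunc F) L] :
    Nonempty (PlaceSystem ((algebraMap (RatFunc F) L).comp (algebraMap F[X] (RatFunc F)))
      (Module.finrank (RatFunc F) L)) := by
  classical
  have := Fintype.ofFinite F
  set g := (algebraMap (RatFunc F) L).comp (algebraMap F[X] (RatFunc F)) with hg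
  let : Algebra F[X] L := g.toAlgebra
  have : IsScalarTower F[X] (RatFunc F) L := IsScalarTower.of_algebraMap_eq fun _ => rfl
  let S := integralClosure F[X] L
  have : IsDedekindDomain S := integralClosure.isDedekindDomain F[X] (RatFunc F) L
  have : IsFractionRing S L :=
    IsIntegralClosure.isFractionRing_of_finite_extension F[X] (RatFunc F) L S
  have : Module.IsTorsionFree F[X] L := .trans_faithfulSMul F[X] (RatFunc F) L
  have : Module.IsTorsionFree F[X] S := IsIntegralClosure.isTorsionFree F[X] L
  have : Module.Finite F[X] S := IsIntegralClosure.finite F[X] (RatFunc F) L S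
  have hrank : Module.finrank F[X] S = Module.finrank (RatFunc F) L :=
    IsIntegralClosure.rank F[X] (RatFunc F) L S
  have hintS : ∀ x : L, g.IsIntegralElem x → ∃ y : S, algebraMap S L y = x := fun x hx =>
    ⟨⟨x, hx⟩, rfl⟩
  have hgS : ∀ a : F[X], g a = algebraMap S L (algebraMap F[X] S a) := fun a => rfl
  refine ⟨⟨HeightOneSpectrum S, fun v x => placeOrd v x, fun v => placeDegree (F := F) v,
    fun v x y hx hy => placeOrd_mul v hx hy, ?_, fun v => one_le_placeDegree v, ?_, ?_⟩⟩
  · intro x hx h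
    obtain ⟨y, rfl⟩ := mem_range_of_placeOrd_eq_zero hx h
    exact y.2
  · intro x a hx ha h1 h2 s
    have hga : g a ≠ 0 := by
      rw [hg, RingHom.comp_apply]
      simpa using ha
    have key : ∀ v : HeightOneSpectrum S,
        ((placeOrd v x).natAbs : ℤ) ≤ placeOrd v (algebraMap S L (algebraMap F[X] S a)) := by
      intro v
      have hpos : ∀ z : L, z ≠ 0 → g.IsIntegralElem (g a * z) →
          0 ≤ placeOrd v (g a) + placeOrd v z := by
        intro z hz hz'
        rw [← placeOrd_mul v hga hz]
        obtain ⟨y, hy⟩ := hintS _ hz'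
        rw [← hy]
        refine placeOrd_algebraMap_nonneg v ?_
        rintro rfl
        rw [map_zero] at hy
        exact mul_ne_zero hga hz hy.symm
      have h3 := hpos x hx h1
      have h4 := hpos x⁻¹ (inv_ne_zero hx) h2
      rw [placeOrd_inv] at h4
      rw [← hgS]
      omega
    have h5 := sum_placeDegree_mul_placeOrd_le (L := L) s a ha
    rw [hrank] at h5
    have h6 : ((∑ v ∈ s, placeDegree (F := F) v * (placeOrd v x).natAbs : ℕ) : ℤ) ≤
        ∑ v ∈ s, (placeDegree (F := F) v : ℤ) *
          placeOrd v (algebraMap S L (algebraMap F[X] S a)) := by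
      push_cast [-Int.natCast_natAbs]
      exact Finset.sum_le_sum fun v _ => mul_le_mul_of_nonneg_left (key v) (by positivity)
    exact_mod_cast h6.trans h5
  · intro m s hs
    rw [← hrank, Nat.card_eq_fintype_card]
    exact card_placeDegree_le m s hs

theorem exists_pow_mem_range_of_isPurelyInseparable (K L : Type*) [Field K] [Field L]
    [Algebra K L] [FiniteDimensional K L] [IsPurelyInseparable K L] :
    ∃ N : ℕ, 1 ≤ N ∧ N ≤ Module.finrank K L ∧ ∀ x : L, x ^ N ∈ (algebraMap K L).range := by
  obtain ⟨p, hp⟩ := ExpChar.exists K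
  have hfin : 0 < Module.finrank K L := Module.finrank_pos
  rcases hp with _ | ⟨hp⟩
  · exact ⟨1, le_rfl, hfin, fun x => IsPurelyInseparable.surjective_algebraMap_of_isSeparable K L _⟩
  · have : ExpChar K p := ExpChar.prime hp
    refine ⟨p ^ Nat.log p (Module.finrank K L), Nat.one_le_pow _ _ hp.pos,
      Nat.pow_log_le_self p hfin.ne', fun x => ?_⟩
    -- The minimal polynomial of `x` has degree `p ^ elemExponent`, which is at most the degree of
    -- the extension.
    have hle : IsPurelyInseparable.elemExponent K x ≤ Nat.log p (Module.finrank K L) :=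
      Nat.le_log_of_pow_le hp.one_lt
        (IsPurelyInseparable.minpoly_natDegree_eq' K p x ▸ minpoly.natDegree_le x)
    obtain ⟨k, hk⟩ := Nat.exists_eq_add_of_le hle
    rw [hk, pow_add, pow_mul]
    exact pow_mem (IsPurelyInseparable.elemExponent_def' K p x) _

/-- Pull the valuations of the separable closure `E` back along the multiplicative map `x ↦ x ^ N`
into `E`. A denominator `a` becomes `a ^ N` with `N ≤ d`, whence the second factor `d`. -/
theorem nonempty_placeSystem {F : Type u} [Field F] [Finite F] {L : Type v}
    [Field L] [Algebra (RatFunc F) L] [FiniteDimensional (RatFunc F) L] :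
    Nonempty (PlaceSystem ((algebraMap (RatFunc F) L).comp (algebraMap F[X] (RatFunc F)))
      (Module.finrank (RatFunc F) L ^ 2)) := by
  set d := Module.finrank (RatFunc F) L with hd
  set g := (algebraMap (RatFunc F) L).comp (algebraMap F[X] (RatFunc F)) with hg
  let E := separableClosure (RatFunc F) L
  obtain ⟨P⟩ := nonempty_placeSystem_of_isSeparable (F := F) (L := E)
  set gE := (algebraMap (RatFunc F) E).comp (algebraMap F[X] (RatFunc F)) with hgE
  have hdpos : 0 < d := Module.finrank_pos
  have hmul : Module.finrank (RatFunc F) E * Module.finrank E L = d :=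
    Module.finrank_mul_finrank _ _ _
  have hE : Module.finrank (RatFunc F) E ≤ d := by
    rw [← hmul]
    exact Nat.le_mul_of_pos_right _ Module.finrank_pos
  have hL : Module.finrank E L ≤ d := by
    rw [← hmul]
    exact Nat.le_mul_of_pos_left _ Module.finrank_pos
  obtain ⟨N, hN1, hNle, hN⟩ := exists_pow_mem_range_of_isPurelyInseparable E L
  choose pw hpw using hN
  have hcomp : (algebraMap E L).comp gE = g := rfl
  have hinj : Function.Injective (algebraMap E L) := (algebraMap E L).injective
  have hpw0 : ∀ x, x ≠ 0 → pw x ≠ 0 := by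
    intro x hx h
    have := hpw x
    rw [h, map_zero] at this
    exact pow_ne_zero N hx this.symm
  have hpwmul : ∀ x y, pw (x * y) = pw x * pw y := fun x y => hinj <| by
    rw [map_mul, hpw, hpw, hpw, mul_pow]
  have hpwinv : ∀ x, pw x⁻¹ = (pw x)⁻¹ := fun x => hinj <| by
    rw [map_inv₀, hpw, hpw, inv_pow]
  have hintE : ∀ y : E, g.IsIntegralElem (algebraMap E L y) → gE.IsIntegralElem y := by
    rintro y ⟨p, hp, hy⟩
    refine ⟨p, hp, hinj ?_⟩
    rw [map_zero, Polynomial.hom_eval₂, hcomp, hy]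
  refine ⟨⟨P.ι, fun i x => P.ord i (pw x), P.deg, ?_, ?_, P.one_le_deg, ?_, ?_⟩⟩
  · intro i x y hx hy
    rw [hpwmul, P.ord_mul i _ _ (hpw0 x hx) (hpw0 y hy)]
  · intro x hx h
    obtain ⟨p, hp, hy⟩ := P.isIntegralElem (pw x) (hpw0 x hx) h
    let : Algebra F[X] L := g.toAlgebra
    have h1 : IsIntegral F[X] (x ^ N) := by
      refine ⟨p, hp, ?_⟩
      have := congrArg (algebraMap E L) hy
      rwa [map_zero, Polynomial.hom_eval₂, hcomp, hpw] at this
    exact h1.of_pow hN1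
  · intro x a hx ha h1 h2 s
    let : Algebra F[X] L := g.toAlgebra
    have hkey : ∀ z : L, g.IsIntegralElem (g a * z) → gE.IsIntegralElem (gE (a ^ N) * pw z) := by
      intro z hz
      refine hintE _ ?_
      have h3 : IsIntegral F[X] ((g a * z) ^ N) := IsIntegral.pow hz N
      rw [map_mul, hpw, ← RingHom.comp_apply, hcomp, map_pow, ← mul_pow]
      exact h3
    have h4 := P.sum_le (pw x) (a ^ N) (hpw0 x hx) (pow_ne_zero N ha) (hkey x h1)
      (hpwinv x ▸ hkey x⁻¹ h2) s
    refine h4.trans ?_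
    rw [Polynomial.natDegree_pow, sq, mul_assoc]
    exact Nat.mul_le_mul hE (Nat.mul_le_mul_right _ (hNle.trans hL))
  · intro m s hs
    refine (P.card_le m s hs).trans (Nat.mul_le_mul_right _ (hE.trans ?_))
    exact Nat.le_self_pow two_ne_zero d

end FunctionFieldHeight

/-! ### The substitution of `T⁻¹` for `T` and the elements integral on both sides. -/

namespace FunctionFieldHeight

open Polynomial

section Inversion

variable (F : Type*) [Field F]

/-- The homomorphism `F[X] → F(X)` sending `X` to `X⁻¹`. -/
noncomputable def invHom : F[X] →+* RatFunc F :=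
  eval₂RingHom RatFunc.C (RatFunc.X)⁻¹

variable {F}

theorem invHom_reflect_mul (n : ℕ) {p : F[X]} (hp : p.natDegree ≤ n) :
    invHom F (reflect n p) * RatFunc.X ^ n = algebraMap F[X] (RatFunc F) p := by
  let : Invertible (RatFunc.X : RatFunc F) := invertibleOfNonzero RatFunc.X_ne_zero
  have h := eval₂_reflect_mul_pow (RatFunc.C : F →+* RatFunc F) RatFunc.X n p hp
  rw [invOf_eq_inv] at h
  rw [invHom, coe_eval₂RingHom, h, ← RatFunc.aeval_X_left_eq_algebraMap, aeval_def,
    RatFunc.algebraMap_eq_C]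

theorem invHom_mul (n : ℕ) {p : F[X]} (hp : p.natDegree ≤ n) :
    invHom F p * RatFunc.X ^ n = algebraMap F[X] (RatFunc F) (reflect n p) := by
  have h : (reflect n p).natDegree ≤ n := natDegree_reflect_le.trans (max_le le_rfl hp)
  simpa using invHom_reflect_mul n h

theorem invHom_injective : Function.Injective (invHom F) := by
  rw [injective_iff_map_eq_zero]
  intro p hp
  have h := invHom_mul p.natDegree (le_refl p.natDegree)
  rw [hp, zero_mul] at h
  simpa using h.symm

variable (F) in
/-- The endomorphism of `F(X)` sending `X` to `X⁻¹`. -/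
noncomputable def invEndo : RatFunc F →+* RatFunc F :=
  IsFractionRing.lift (A := F[X]) (invHom_injective (F := F))

theorem invEndo_algebraMap (p : F[X]) :
    invEndo F (algebraMap F[X] (RatFunc F) p) = invHom F p :=
  IsFractionRing.lift_algebraMap _ p

theorem invEndo_X : invEndo F RatFunc.X = (RatFunc.X)⁻¹ := by
  rw [← RatFunc.algebraMap_X, invEndo_algebraMap]
  simp [invHom]

theorem invEndo_C (c : F) : invEndo F (RatFunc.C c) = RatFunc.C c := by
  rw [← RatFunc.algebraMap_C, invEndo_algebraMap]
  simp [invHom]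

theorem invEndo_invHom (p : F[X]) : invEndo F (invHom F p) = algebraMap F[X] (RatFunc F) p := by
  have h : (invEndo F).comp (invHom F) = algebraMap F[X] (RatFunc F) := by
    refine Polynomial.ringHom_ext (fun c => ?_) ?_
    · simp [invHom, invEndo_C]
    · simp [invHom, invEndo_X]
  exact RingHom.congr_fun h p

theorem invEndo_invEndo (x : RatFunc F) : invEndo F (invEndo F x) = x := by
  have h : (invEndo F).comp (invEndo F) = RingHom.id _ := by
    refine IsLocalization.ringHom_ext (nonZeroDivisors F[X]) (RingHom.ext fun p => ?_)
    simp [invEndo_algebraMap, invEndo_invHom]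
  exact RingHom.congr_fun h x

variable (F) in
/-- The automorphism of `F(X)` sending `X` to `X⁻¹`. -/
noncomputable def invEquiv : RatFunc F ≃+* RatFunc F :=
  RingEquiv.ofRingHom (invEndo F) (invEndo F) (RingHom.ext invEndo_invEndo)
    (RingHom.ext invEndo_invEndo)

/-- An element of `F[X]` which is also a polynomial in `X⁻¹` is constant. -/
theorem natDegree_eq_zero_of_algebraMap_eq_invHom {p r : F[X]}
    (h : algebraMap F[X] (RatFunc F) p = invHom F r) : p.natDegree = 0 := by
  by_cases hp : p = 0
  · simp [hp]
  have h1 := invHom_mul r.natDegree (le_refl r.natDegree)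
  rw [← h, ← RatFunc.algebraMap_X, ← map_pow, ← map_mul] at h1
  have h2 := congrArg natDegree (RatFunc.algebraMap_injective F h1)
  rw [natDegree_mul_X_pow _ hp] at h2
  have h3 : (reflect r.natDegree r).natDegree ≤ r.natDegree :=
    natDegree_reflect_le.trans (max_le le_rfl le_rfl)
  omega

end Inversion

section TwoSystems

variable {F : Type u} [Field F] {K : Type v} [Field K] [Algebra (RatFunc F) K]

variable (F K) in
/-- The inclusion of `F[X]` in an extension of `F(X)`. -/
noncomputable def polyHom : F[X] →+* K :=
  (algebraMap (RatFunc F) K).comp (algebraMap F[X] (RatFunc F))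

variable (F K) in
/-- The homomorphism from `F[X]` to an extension of `F(X)` sending `X` to `X⁻¹`. -/
noncomputable def polyInvHom : F[X] →+* K :=
  (algebraMap (RatFunc F) K).comp (invHom F)

/-- The separate type `L` keeps two `RatFunc F`-algebra structures on the same field apart;
finiteness and degree are transported along `hc`. -/
theorem nonempty_placeSystem_of_ringEquiv [Finite F] [FiniteDimensional (RatFunc F) K]
    {L : Type v} [Field L] [Algebra (RatFunc F) L] (j : K ≃+* L)
    (hc : (algebraMap (RatFunc F) L).comp (invEquiv F).toRingHom =
      j.toRingHom.comp (algebraMap (RatFunc F) K)) :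
    Nonempty (PlaceSystem (polyHom F L) (Module.finrank (RatFunc F) K ^ 2)) := by
  have := Module.Finite.of_equiv_equiv (invEquiv F) j hc
  rw [Algebra.finrank_eq_of_equiv_equiv (invEquiv F) j hc]
  exact nonempty_placeSystem

theorem nonempty_placeSystem_polyInvHom [Finite F] [FiniteDimensional (RatFunc F) K] :
    Nonempty (PlaceSystem (polyInvHom F K) (Module.finrank (RatFunc F) K ^ 2)) := by
  have h := @nonempty_placeSystem_of_ringEquiv F _ K _ _ _ _ K _
    ((algebraMap (RatFunc F) K).comp (invEndo F)).toAlgebra (RingEquiv.refl K)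
    (RingHom.ext fun x => congrArg (algebraMap (RatFunc F) K) (invEndo_invEndo x))
  convert h using 2
  refine RingHom.ext fun p => ?_
  exact congrArg (algebraMap (RatFunc F) K) (invEndo_algebraMap p).symm

/-- Monic factors of monic polynomials over an integrally closed domain have coefficients there.
Applied to `F[X]` directly and after `invEndo`, this puts each coefficient in `F[X] ∩ F[X⁻¹]`. -/
theorem exists_coeff_minpoly_eq_C [FiniteDimensional (RatFunc F) K] {x : K}
    (h1 : (polyHom F K).IsIntegralElem x) (h2 : (polyInvHom F K).IsIntegralElem x) (i : ℕ) :
    ∃ c : F, (minpoly (RatFunc F) x).coeff i = RatFunc.C c := by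
  have hmonic : (minpoly (RatFunc F) x).Monic :=
    minpoly.monic (Algebra.IsIntegral.isIntegral x)
  obtain ⟨p, hp, hpx⟩ := h1
  obtain ⟨r, hr, hrx⟩ := h2
  have hd1 : minpoly (RatFunc F) x ∣ p.map (algebraMap F[X] (RatFunc F)) := by
    refine minpoly.dvd _ _ ?_
    rw [aeval_def, eval₂_map]
    exact hpx
  have hd2 : (minpoly (RatFunc F) x).map (invEndo F) ∣
      r.map (algebraMap F[X] (RatFunc F)) := by
    have h3 : minpoly (RatFunc F) x ∣ r.map (invHom F) := by
      refine minpoly.dvd _ _ ?_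
      rw [aeval_def, eval₂_map]
      exact hrx
    have h4 := Polynomial.map_dvd (invEndo F) h3
    rw [Polynomial.map_map] at h4
    convert h4 using 2
    exact RingHom.ext fun s => (invEndo_invHom s).symm
  obtain ⟨p', hp'⟩ := IsIntegrallyClosed.eq_map_mul_C_of_dvd (RatFunc F) hp hd1
  obtain ⟨r', hr'⟩ := IsIntegrallyClosed.eq_map_mul_C_of_dvd (RatFunc F) hr hd2
  rw [hmonic.leadingCoeff, C_1, mul_one] at hp'
  rw [(hmonic.map (invEndo F)).leadingCoeff, C_1, mul_one] at hr'
  have e1 : algebraMap F[X] (RatFunc F) (p'.coeff i) = (minpoly (RatFunc F) x).coeff i := by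
    rw [← hp', coeff_map]
  have e2 : invHom F (r'.coeff i) = (minpoly (RatFunc F) x).coeff i := by
    have h5 := congrArg (fun P : (RatFunc F)[X] => P.coeff i) hr'
    simp only [coeff_map] at h5
    rw [← invEndo_invEndo ((minpoly (RatFunc F) x).coeff i), ← h5, invEndo_algebraMap]
  have h0 := natDegree_eq_zero_of_algebraMap_eq_invHom (e1.trans e2.symm)
  obtain ⟨c, hc⟩ := natDegree_eq_zero.1 h0
  exact ⟨c, by rw [← e1, ← hc, RatFunc.algebraMap_C]⟩

/-- At most `q ^ (d + 1)` minimal polynomials occur, each with at most `d` roots. -/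
theorem card_integral_le [Finite F] [FiniteDimensional (RatFunc F) K] (s : Finset K)
    (h1 : ∀ x ∈ s, (polyHom F K).IsIntegralElem x)
    (h2 : ∀ x ∈ s, (polyInvHom F K).IsIntegralElem x) :
    s.card ≤ Module.finrank (RatFunc F) K *
      Nat.card F ^ (Module.finrank (RatFunc F) K + 1) := by
  classical
  have := Fintype.ofFinite F
  set d := Module.finrank (RatFunc F) K with hd
  have hex : ∀ x : K, ∀ i : ℕ, ∃ c : F, x ∈ s → (minpoly (RatFunc F) x).coeff i = RatFunc.C c := by
    intro x i
    by_cases hx : x ∈ s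
    · obtain ⟨c, hc⟩ := exists_coeff_minpoly_eq_C (h1 x hx) (h2 x hx) i
      exact ⟨c, fun _ => hc⟩
    · exact ⟨0, fun h => absurd h hx⟩
  choose c hc using hex
  have hdeg : ∀ x : K, (minpoly (RatFunc F) x).natDegree ≤ d := fun x => minpoly.natDegree_le x
  have hfib : ∀ b ∈ s.image (fun x (i : Fin (d + 1)) => c x i),
      (s.filter (fun x => (fun i : Fin (d + 1) => c x i) = b)).card ≤ d := by
    intro b hb
    obtain ⟨x, hx, rfl⟩ := Finset.mem_image.1 hb
    have hmon : (minpoly (RatFunc F) x).Monic := minpoly.monic (Algebra.IsIntegral.isIntegral x)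
    set Q := (minpoly (RatFunc F) x).map (algebraMap (RatFunc F) K) with hQ
    have hQ0 : Q ≠ 0 := (hmon.map _).ne_zero
    have hsub : s.filter (fun y => (fun i : Fin (d + 1) => c y i) = fun i : Fin (d + 1) => c x i) ⊆
        Q.roots.toFinset := by
      intro y hy
      obtain ⟨hys, hyx⟩ := Finset.mem_filter.1 hy
      have heq : minpoly (RatFunc F) y = minpoly (RatFunc F) x := by
        ext1 i
        by_cases hi : i < d + 1
        · rw [hc y i hys, hc x i hx, congrFun hyx (⟨i, hi⟩ : Fin (d + 1))]
        · rw [coeff_eq_zero_of_natDegree_lt ((hdeg y).trans_lt (by omega)),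
            coeff_eq_zero_of_natDegree_lt ((hdeg x).trans_lt (by omega))]
      rw [Multiset.mem_toFinset, mem_roots hQ0, IsRoot.def, hQ, eval_map, ← heq, ← aeval_def]
      exact minpoly.aeval _ _
    calc _ ≤ Q.roots.toFinset.card := Finset.card_le_card hsub
      _ ≤ Multiset.card Q.roots := Multiset.toFinset_card_le _
      _ ≤ Q.natDegree := card_roots' _
      _ ≤ d := natDegree_map_le.trans (hdeg x)
  refine (Finset.card_le_mul_card_image s d hfib).trans (Nat.mul_le_mul_left _ ?_)
  refine (Finset.card_le_univ _).trans ?_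
  simp [Nat.card_eq_fintype_card]

end TwoSystems

/-! ### Common denominators, and their degree in terms of the height. -/

section Denominators

variable {F : Type u} [Field F] {L : Type v} [Field L]

/-- `x` and `x⁻¹` have a common denominator of degree at most `n` with respect to
`g : F[X] →+* L`. -/
def HasDenominator (g : F[X] →+* L) (n : ℕ) (x : L) : Prop :=
  ∃ a : F[X], a ≠ 0 ∧ a.natDegree ≤ n ∧ g.IsIntegralElem (g a * x) ∧ g.IsIntegralElem (g a * x⁻¹)

theorem HasDenominator.mono {g : F[X] →+* L} {m n : ℕ} {x : L} (h : HasDenominator g m x)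
    (hmn : m ≤ n) : HasDenominator g n x := by
  obtain ⟨a, h0, h1, h2⟩ := h
  exact ⟨a, h0, h1.trans hmn, h2⟩

theorem HasDenominator.one (g : F[X] →+* L) : HasDenominator g 0 1 :=
  ⟨1, one_ne_zero, by simp, by simpa using g.isIntegralElem_one,
    by simpa using g.isIntegralElem_one⟩

theorem HasDenominator.mul {g : F[X] →+* L} {m n : ℕ} {x y : L} (hx : HasDenominator g m x)
    (hy : HasDenominator g n y) : HasDenominator g (m + n) (x * y) := by
  obtain ⟨a, ha0, ha1, ha2, ha3⟩ := hx
  obtain ⟨b, hb0, hb1, hb2, hb3⟩ := hy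
  refine ⟨a * b, mul_ne_zero ha0 hb0, natDegree_mul_le.trans (add_le_add ha1 hb1), ?_, ?_⟩
  · rw [map_mul, mul_mul_mul_comm]
    exact RingHom.IsIntegralElem.mul g ha2 hb2
  · rw [map_mul, mul_inv, mul_mul_mul_comm]
    exact RingHom.IsIntegralElem.mul g ha3 hb3

/-- The leading coefficient clears `x`; the trailing one, leading in the reversed polynomial, clears
`x⁻¹`. Their product does both, hence `2 * n`. -/
theorem hasDenominator_of_eval₂_eq_zero (g : F[X] →+* L) {x : L} (hx : x ≠ 0) {n : ℕ}
    {P : F[X][X]} (hP : P ≠ 0) (hdeg : ∀ i, (P.coeff i).natDegree ≤ n)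
    (h : P.eval₂ g x = 0) : HasDenominator g (2 * n) x := by
  have h1 : g.IsIntegralElem (g P.leadingCoeff * x) := g.isIntegralElem_leadingCoeff_mul P x h
  have h2 : g.IsIntegralElem (g P.trailingCoeff * x⁻¹) := by
    let := invertibleOfNonzero hx
    rw [← reverse_leadingCoeff]
    refine g.isIntegralElem_leadingCoeff_mul P.reverse x⁻¹ ?_
    rw [← invOf_eq_inv]
    exact (eval₂_reverse_eq_zero_iff g x P).2 h
  refine ⟨P.leadingCoeff * P.trailingCoeff, mul_ne_zero (leadingCoeff_ne_zero.2 hP)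
    (trailingCoeff_nonzero_iff_nonzero.2 hP), ?_, ?_, ?_⟩
  · refine natDegree_mul_le.trans ?_
    have := hdeg P.natDegree
    have := hdeg P.natTrailingDegree
    rw [leadingCoeff, trailingCoeff]
    omega
  · rw [map_mul, mul_right_comm, mul_comm]
    exact RingHom.IsIntegralElem.mul g g.isIntegralElem_map h1
  · rw [map_mul, mul_assoc]
    exact RingHom.IsIntegralElem.mul g g.isIntegralElem_map h2

end Denominators

section Height

variable {F : Type u} [Field F] {K : Type v} [Field K] [Algebra (RatFunc F) K]
  [FiniteDimensional (RatFunc F) K]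

theorem exists_poly_of_height_le {x : K} {n : ℕ} (h : height F x ≤ n) :
    ∃ P : F[X][X], P ≠ 0 ∧ (∀ i, (P.coeff i).natDegree ≤ n) ∧ P.eval₂ (polyHom F K) x = 0 := by
  obtain ⟨P, hP⟩ := exists_isMinpoly (F := F) x
  refine ⟨P, hP.1.ne_zero, fun i => ?_, ?_⟩
  · rw [height_eq hP] at h
    by_cases hi : i ∈ P.support
    · exact (Finset.le_sup (f := fun i => (P.coeff i).natDegree) hi).trans h
    · rw [notMem_support_iff.1 hi]; simp
  · have h2 := hP.2
    rw [aeval_def, eval₂_map] at h2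
    exact h2

theorem hasDenominator_polyHom {x : K} (hx : x ≠ 0) {n : ℕ} (h : height F x ≤ n) :
    HasDenominator (polyHom F K) (2 * n) x := by
  obtain ⟨P, hP, hdeg, hPx⟩ := exists_poly_of_height_le h
  exact hasDenominator_of_eval₂_eq_zero _ hx hP hdeg hPx

theorem hasDenominator_polyInvHom {x : K} (hx : x ≠ 0) {n : ℕ} (h : height F x ≤ n) :
    HasDenominator (polyInvHom F K) (2 * n) x := by
  obtain ⟨P, hP, hdeg, hPx⟩ := exists_poly_of_height_le h
  -- Since `p(T) = T ^ n * (reflect n p)(T⁻¹)`, evaluating `Q` through `polyInvHom` gives `T ^ (-n)`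
  -- times the value of `P` at `x`, that is, 0.
  set Q : F[X][X] := ∑ i ∈ P.support, monomial i (reflect n (P.coeff i)) with hQ
  have hcoeff : ∀ j, Q.coeff j = reflect n (P.coeff j) := by
    intro j
    rw [hQ, finsetSum_coeff]
    simp only [coeff_monomial]
    rw [Finset.sum_ite_eq' P.support j]
    split_ifs with hj
    · rfl
    · rw [notMem_support_iff.1 hj, reflect_zero]
  have hX : algebraMap (RatFunc F) K (RatFunc.X ^ n) ≠ 0 := by
    simpa using fun h => absurd h RatFunc.X_ne_zero
  refine hasDenominator_of_eval₂_eq_zero _ hx (P := Q) ?_ ?_ ?_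
  · intro h0
    apply hP
    ext1 j
    have := hcoeff j
    rw [h0, coeff_zero] at this
    simpa using this.symm
  · intro j
    rw [hcoeff]
    exact natDegree_reflect_le.trans (max_le le_rfl (hdeg j))
  · refine (mul_eq_zero.1 (?_ : Q.eval₂ (polyInvHom F K) x *
      algebraMap (RatFunc F) K (RatFunc.X ^ n) = 0)).resolve_right hX
    rw [hQ, eval₂_finsetSum, Finset.sum_mul, ← hPx, eval₂_eq_sum, Polynomial.sum]
    refine Finset.sum_congr rfl fun i _ => ?_
    rw [eval₂_monomial, polyHom, RingHom.comp_apply, ← invHom_reflect_mul n (hdeg i), map_mul,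
      polyInvHom, RingHom.comp_apply]
    ring

end Height

end FunctionFieldHeight

/-! ### The product set bound and the choice of the degree threshold. -/

namespace FunctionFieldHeight

open Polynomial

theorem PlaceSystem.ord_mul_inv_eq_zero {F : Type u} [Field F] {L : Type v} [Field L]
    {g : F[X] →+* L} {D : ℕ} (P : PlaceSystem g D) {x y : L} (hx : x ≠ 0) (hy : y ≠ 0) {i : P.ι}
    (h : P.ord i y = P.ord i x) : P.ord i (y * x⁻¹) = 0 := by
  have h1 := P.ord_mul i 1 1 one_ne_zero one_ne_zero
  have h2 := P.ord_mul i x x⁻¹ hx (inv_ne_zero hx)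
  rw [mul_one] at h1
  rw [mul_inv_cancel₀ hx] at h2
  rw [P.ord_mul i y x⁻¹ hy (inv_ne_zero hx), h]
  omega

section

variable {F : Type u} [Field F] [Finite F] {K : Type v} [Field K] [DecidableEq K]
  [Algebra (RatFunc F) K] [FiniteDimensional (RatFunc F) K]

theorem card_mul_card_le_of_hasDenominator {q d : ℕ} (hq : Nat.card F = q)
    (hd : Module.finrank (RatFunc F) K = d) (m n : ℕ) {A B : Finset K}
    (h0 : ∀ x ∈ A ∪ B, x ≠ 0)
    (h1 : ∀ x ∈ A ∪ B, HasDenominator (polyHom F K) n x)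
    (h2 : ∀ x ∈ A ∪ B, HasDenominator (polyInvHom F K) n x) :
    (A.card : ℝ) * B.card ≤ ((d * q ^ (d + 1) : ℕ) : ℝ) ^ 2 *
      ((2 * (2 * d ^ 2 * n : ℕ) + 1 : ℝ) ^ (2 * d ^ 2 * q ^ (m + 1)) *
        16 ^ (2 * d ^ 2 * n / (m + 1))) ^ 2 * (A * B).card := by
  classical
  subst hq hd
  set d := Module.finrank (RatFunc F) K with hd
  obtain ⟨P⟩ : Nonempty (PlaceSystem (polyHom F K) (d ^ 2)) := nonempty_placeSystem
  obtain ⟨Q⟩ : Nonempty (PlaceSystem (polyInvHom F K) (d ^ 2)) :=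
    nonempty_placeSystem_polyInvHom
  refine ProductSet.card_mul_card_le (Sum.elim P.ord Q.ord) (Sum.elim P.deg Q.deg)
    ?_ ?_ ?_ ?_ ?_
  · intro i x hx y hy
    have hx0 := h0 x (Finset.mem_union_left _ hx)
    have hy0 := h0 y (Finset.mem_union_right _ hy)
    cases i with
    | inl i => exact P.ord_mul i x y hx0 hy0
    | inr i => exact Q.ord_mul i x y hx0 hy0
  · intro C hC x hx hCx
    have hx0 := h0 x (hC hx)
    have hinj : Set.InjOn (fun y => y * x⁻¹) (C : Set K) := fun y _ z _ h =>
      mul_right_cancel₀ (inv_ne_zero hx0) h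
    rw [← Finset.card_image_of_injOn hinj]
    refine card_integral_le _ (fun z hz => ?_) (fun z hz => ?_)
    · obtain ⟨y, hy, rfl⟩ := Finset.mem_image.1 hz
      have hy0 := h0 y (hC hy)
      exact P.isIntegralElem _ (mul_ne_zero hy0 (inv_ne_zero hx0)) fun i =>
        P.ord_mul_inv_eq_zero hx0 hy0 (hCx y hy (Sum.inl i))
    · obtain ⟨y, hy, rfl⟩ := Finset.mem_image.1 hz
      have hy0 := h0 y (hC hy)
      exact Q.isIntegralElem _ (mul_ne_zero hy0 (inv_ne_zero hx0)) fun i =>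
        Q.ord_mul_inv_eq_zero hx0 hy0 (hCx y hy (Sum.inr i))
  · intro i
    cases i with
    | inl i => exact P.one_le_deg i
    | inr i => exact Q.one_le_deg i
  · intro x hx s
    obtain ⟨a, ha0, ha, ha1, ha2⟩ := h1 x hx
    obtain ⟨b, hb0, hb, hb1, hb2⟩ := h2 x hx
    rw [← s.toLeft_disjSum_toRight, Finset.sum_disjSum]
    have h3 := P.sum_le x a (h0 x hx) ha0 ha1 ha2 s.toLeft
    have h4 := Q.sum_le x b (h0 x hx) hb0 hb1 hb2 s.toRight
    have h5 : d ^ 2 * a.natDegree ≤ d ^ 2 * n := Nat.mul_le_mul_left _ ha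
    have h6 : d ^ 2 * b.natDegree ≤ d ^ 2 * n := Nat.mul_le_mul_left _ hb
    simp only [Sum.elim_inl, Sum.elim_inr]
    rw [mul_assoc, two_mul]
    exact add_le_add (h3.trans h5) (h4.trans h6)
  · intro s hs
    rw [← s.toLeft_disjSum_toRight, Finset.card_disjSum, mul_assoc, two_mul]
    refine add_le_add (P.card_le m _ fun i hi => ?_) (Q.card_le m _ fun i hi => ?_)
    · exact hs _ (Finset.mem_toLeft.1 hi)
    · exact hs _ (Finset.mem_toRight.1 hi)

end

/-- Serves to absorb `√n * log n`, the cost of the places of small degree, into `n / log n`. -/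
theorem log_sq_le_sqrt {x : ℝ} (hx : 1 ≤ x) : Real.log x ^ 2 ≤ 16 * √x := by
  have hx0 : 0 < x := by linarith
  have h1 : Real.log x = 4 * Real.log (√(√x)) := by
    rw [Real.log_sqrt (Real.sqrt_nonneg _), Real.log_sqrt hx0.le]; ring
  have h2 : Real.log (√(√x)) ≤ √(√x) := Real.log_le_self (Real.sqrt_nonneg _)
  have h3 : 0 ≤ Real.log (√(√x)) := by
    have := Real.log_nonneg hx
    linarith
  have h4 : √(√x) ^ 2 = √x := Real.sq_sqrt (Real.sqrt_nonneg _)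
  rw [h1]
  nlinarith

theorem exists_threshold (q D R : ℕ) (hq : 2 ≤ q) : ∃ C : ℝ, 0 < C ∧ ∀ n : ℕ, 3 ≤ n → ∃ m : ℕ,
    (R : ℝ) ^ 2 * ((2 * (2 * D * n : ℕ) + 1 : ℝ) ^ (2 * D * q ^ (m + 1)) *
        16 ^ (2 * D * n / (m + 1))) ^ 2 ≤ Real.exp (C * (n / Real.log n)) := by
  have hq1 : (1 : ℝ) < q := by exact_mod_cast hq
  have hlq : 0 < Real.log q := Real.log_pos hq1
  set a : ℝ := Real.log (4 * D + 1) + 1 with ha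
  have ha1 : 1 ≤ a := by
    have : 0 ≤ Real.log (4 * D + 1 : ℝ) := Real.log_nonneg (by
      have : (0 : ℝ) ≤ D := by positivity
      linarith)
    linarith
  refine ⟨2 * R + 2 * (2 * D * q * (16 * a)) + 2 * (4 * D * Real.log q * Real.log 16) + 1,
    by positivity, fun n hn => ?_⟩
  have hn3 : (3 : ℝ) ≤ n := by exact_mod_cast hn
  have hn0 : (0 : ℝ) < n := by linarith
  have hln1 : 1 ≤ Real.log n := by
    rw [Real.le_log_iff_exp_le hn0]
    exact (Real.exp_one_lt_d9.le.trans (by norm_num)).trans hn3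
  have hln0 : 0 < Real.log n := by linarith
  set T : ℝ := n / Real.log n with hT
  have hT1 : 1 ≤ T := by
    rw [hT, one_le_div hln0]
    exact Real.log_le_self hn0.le
  -- This keeps `q ^ m ≤ √n` while `m + 1` is still of order `log n`.
  set m := ⌊Real.log n / (2 * Real.log q)⌋₊ with hm
  refine ⟨m, ?_⟩
  have hm1 : (m : ℝ) * (2 * Real.log q) ≤ Real.log n := by
    rw [← le_div_iff₀ (by positivity)]
    exact Nat.floor_le (by positivity)
  have hm2 : Real.log n ≤ (m + 1) * (2 * Real.log q) := by
    rw [← div_le_iff₀ (by positivity)]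
    exact (Nat.lt_floor_add_one _).le
  have hqm : (q : ℝ) ^ m ≤ √n := by
    rw [← Real.log_le_log_iff (by positivity) (Real.sqrt_pos.2 hn0), Real.log_pow,
      Real.log_sqrt hn0.le]
    linarith
  have hsq : √(n : ℝ) * Real.log n ≤ 16 * T := by
    rw [hT, ← mul_div_assoc, le_div_iff₀ hln0]
    have h1 := log_sq_le_sqrt (by linarith : (1 : ℝ) ≤ n)
    have h2 : √(n : ℝ) * √n = n := Real.mul_self_sqrt hn0.le
    nlinarith [Real.sqrt_nonneg (n : ℝ)]
  have hlogM : Real.log (2 * (2 * D * n : ℕ) + 1 : ℝ) ≤ a * Real.log n := by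
    have hle : (2 * (2 * D * n : ℕ) + 1 : ℝ) ≤ (4 * D + 1) * n := by
      push_cast
      nlinarith
    calc Real.log (2 * (2 * D * n : ℕ) + 1 : ℝ) ≤ Real.log ((4 * D + 1) * n) :=
          Real.log_le_log (by positivity) hle
      _ = (a - 1) + Real.log n := by
          rw [Real.log_mul (by positivity) hn0.ne', ha]; ring
      _ ≤ a * Real.log n := by nlinarith
  have hR : (R : ℝ) ^ 2 ≤ Real.exp (2 * R * T) := by
    have h1 : (R : ℝ) ≤ Real.exp R := by linarith [Real.add_one_le_exp (R : ℝ)]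
    calc (R : ℝ) ^ 2 ≤ Real.exp R ^ 2 := pow_le_pow_left₀ (by positivity) h1 2
      _ = Real.exp (2 * R) := by rw [← Real.exp_nat_mul]; norm_num
      _ ≤ _ := Real.exp_le_exp.2 (le_mul_of_one_le_right (by positivity) hT1)
  have hsmall : (2 * (2 * D * n : ℕ) + 1 : ℝ) ^ (2 * D * q ^ (m + 1)) ≤
      Real.exp (2 * D * q * (16 * a) * T) := by
    rw [← Real.exp_log (by positivity : (0 : ℝ) < 2 * (2 * D * n : ℕ) + 1), ← Real.exp_nat_mul]
    refine Real.exp_le_exp.2 ?_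
    calc ((2 * D * q ^ (m + 1) : ℕ) : ℝ) * Real.log (2 * (2 * D * n : ℕ) + 1 : ℝ)
        ≤ ((2 * D * q ^ (m + 1) : ℕ) : ℝ) * (a * Real.log n) :=
          mul_le_mul_of_nonneg_left hlogM (by positivity)
      _ = 2 * D * q * a * ((q : ℝ) ^ m * Real.log n) := by push_cast; ring
      _ ≤ 2 * D * q * a * (√n * Real.log n) :=
          mul_le_mul_of_nonneg_left (mul_le_mul_of_nonneg_right hqm hln0.le) (by positivity)
      _ ≤ 2 * D * q * a * (16 * T) := mul_le_mul_of_nonneg_left hsq (by positivity)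
      _ = _ := by ring
  have hbig : (16 : ℝ) ^ (2 * D * n / (m + 1)) ≤
      Real.exp (4 * D * Real.log q * Real.log 16 * T) := by
    have h16 : (0 : ℝ) < Real.log 16 := Real.log_pos (by norm_num)
    have h1 : ((2 * D * n / (m + 1) : ℕ) : ℝ) ≤ 4 * D * Real.log q * T := by
      refine (Nat.cast_div_le).trans ?_
      push_cast
      rw [div_le_iff₀ (by positivity), hT]
      calc (2 * D * n : ℝ) = 2 * D * (n / Real.log n) * Real.log n := by field_simp
        _ ≤ 2 * D * (n / Real.log n) * ((m + 1) * (2 * Real.log q)) :=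
            mul_le_mul_of_nonneg_left hm2 (by positivity)
        _ = _ := by ring
    calc (16 : ℝ) ^ (2 * D * n / (m + 1)) =
          Real.exp ((2 * D * n / (m + 1) : ℕ) * Real.log 16) := by
          rw [Real.exp_nat_mul, Real.exp_log (by norm_num)]
      _ ≤ _ := Real.exp_le_exp.2 (by nlinarith)
  calc _ ≤ Real.exp (2 * R * T) * (Real.exp (2 * D * q * (16 * a) * T) *
        Real.exp (4 * D * Real.log q * Real.log 16 * T)) ^ 2 := by
        gcongr
    _ = Real.exp (2 * R * T + 2 * (2 * D * q * (16 * a) * T +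
        4 * D * Real.log q * Real.log 16 * T)) := by
        rw [← Real.exp_add, ← Real.exp_nat_mul, ← Real.exp_add]
        norm_num
    _ ≤ _ := Real.exp_le_exp.2 (by nlinarith)

/-- The product set bound for sets of nonzero elements with denominators of degree at most `n`. -/
theorem exists_card_mul_card_le (q d : ℕ) (hq : 2 ≤ q) : ∃ C : ℝ, 0 < C ∧
    ∀ (F : Type u) [Field F] [Finite F] (K : Type v) [Field K] [DecidableEq K]
      [Algebra (RatFunc F) K] [FiniteDimensional (RatFunc F) K],
      Nat.card F = q → Module.finrank (RatFunc F) K = d →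
      ∀ n : ℕ, 3 ≤ n → ∀ A B : Finset K, (∀ x ∈ A ∪ B, x ≠ 0) →
        (∀ x ∈ A ∪ B, HasDenominator (polyHom F K) n x) →
        (∀ x ∈ A ∪ B, HasDenominator (polyInvHom F K) n x) →
        (A.card : ℝ) * B.card ≤ Real.exp (C * (n / Real.log n)) * (A * B).card := by
  obtain ⟨C, hC, h⟩ := exists_threshold q (d ^ 2) (d * q ^ (d + 1)) hq
  refine ⟨C, hC, ?_⟩
  intro F _ _ K _ _ _ _ hF hK n hn A B h0 h1 h2
  obtain ⟨m, hm⟩ := h n hn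
  exact (card_mul_card_le_of_hasDenominator hF hK m n h0 h1 h2).trans
    (mul_le_mul_of_nonneg_right hm (by positivity))

theorem exists_card_pow_le (q d ν : ℕ) (hq : 2 ≤ q) (hν : 0 < ν) : ∃ C : ℝ, 0 < C ∧
    ∀ (F : Type u) [Field F] [Finite F] (K : Type v) [Field K] [DecidableEq K]
      [Algebra (RatFunc F) K] [FiniteDimensional (RatFunc F) K],
      Nat.card F = q → Module.finrank (RatFunc F) K = d →
      ∀ n : ℕ, 3 ≤ n → ∀ A : Finset K, (∀ x ∈ A, x ≠ 0) →
        (∀ x ∈ A, HasDenominator (polyHom F K) n x) →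
        (∀ x ∈ A, HasDenominator (polyInvHom F K) n x) →
        (A.card : ℝ) ^ ν ≤ Real.exp (C * (n / Real.log n)) * (A ^ ν).card := by
  obtain ⟨C, hC, h⟩ := exists_card_mul_card_le.{u, v} q d hq
  -- There are `ν` multiplications, each with denominators of degree at most `ν * n`, and `ν * n /
  -- log (ν * n) ≤ ν * (n / log n)`.
  refine ⟨ν * (C * ν), by positivity, ?_⟩
  intro F _ _ K _ _ _ _ hF hK n hn A h0 h1 h2
  have hmem : ∀ j : ℕ, ∀ x ∈ A ^ j, x ≠ 0 ∧ HasDenominator (polyHom F K) (j * n) x ∧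
      HasDenominator (polyInvHom F K) (j * n) x := by
    intro j
    induction j with
    | zero =>
      intro x hx
      rw [pow_zero, Finset.mem_one] at hx
      subst hx
      rw [zero_mul]
      exact ⟨one_ne_zero, HasDenominator.one _, HasDenominator.one _⟩
    | succ j ih =>
      intro x hx
      rw [pow_succ] at hx
      obtain ⟨y, hy, z, hz, rfl⟩ := Finset.mem_mul.1 hx
      rw [Nat.succ_mul]
      exact ⟨mul_ne_zero (ih y hy).1 (h0 z hz), (ih y hy).2.1.mul (h1 z hz),
        (ih y hy).2.2.mul (h2 z hz)⟩
  have hN : 3 ≤ ν * n := hn.trans (Nat.le_mul_of_pos_left n hν)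
  have hn0 : (0 : ℝ) < n := by exact_mod_cast (by omega : 0 < n)
  have hln : 0 < Real.log n := Real.log_pos (by exact_mod_cast (by omega : 1 < n))
  set E : ℝ := Real.exp (C * ((ν * n : ℕ) / Real.log (ν * n : ℕ))) with hE
  have hstep : ∀ j : ℕ, j ≤ ν → (A.card : ℝ) ^ j ≤ E ^ j * (A ^ j).card := by
    intro j
    induction j with
    | zero => intro _; simp
    | succ j ih =>
      intro hj
      have h3 := h F K hF hK (ν * n) hN (A ^ j) A
        (fun x hx => (Finset.mem_union.1 hx).elim (fun hx => (hmem j x hx).1) (h0 x))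
        (fun x hx => (Finset.mem_union.1 hx).elim
          (fun hx => (hmem j x hx).2.1.mono (Nat.mul_le_mul_right n (by omega)))
          fun hx => (h1 x hx).mono (Nat.le_mul_of_pos_left n hν))
        (fun x hx => (Finset.mem_union.1 hx).elim
          (fun hx => (hmem j x hx).2.2.mono (Nat.mul_le_mul_right n (by omega)))
          fun hx => (h2 x hx).mono (Nat.le_mul_of_pos_left n hν))
      calc (A.card : ℝ) ^ (j + 1) = (A.card : ℝ) ^ j * A.card := pow_succ _ _
        _ ≤ E ^ j * (A ^ j).card * A.card :=
            mul_le_mul_of_nonneg_right (ih (by omega)) (by positivity)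
        _ = E ^ j * ((A ^ j).card * A.card) := by ring
        _ ≤ E ^ j * (E * (A ^ j * A).card) := mul_le_mul_of_nonneg_left h3 (by positivity)
        _ = _ := by rw [pow_succ A, pow_succ E]; ring
  refine (hstep ν le_rfl).trans (mul_le_mul_of_nonneg_right ?_ (by positivity))
  rw [hE, ← Real.exp_nat_mul]
  refine Real.exp_le_exp.2 ?_
  rw [mul_assoc, mul_assoc]
  refine mul_le_mul_of_nonneg_left (mul_le_mul_of_nonneg_left ?_ hC.le) (by positivity)
  rw [← mul_div_assoc]
  push_cast
  refine div_le_div_of_nonneg_left (by positivity) hln (Real.log_le_log hn0 ?_)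
  exact le_mul_of_one_le_left hn0.le (by exact_mod_cast hν)

/-- Denominators have degree `2 * ⌊h⌋₊`; the extra 1 makes the argument at least 3, so its logarithm
is at least 1 even when `log h` is near 0, and it therefore dominates `√(log h)`. -/
theorem div_log_le {h : ℝ} (hh : 1 < h) :
    ((2 * ⌊h⌋₊ + 1 : ℕ) : ℝ) / Real.log (2 * ⌊h⌋₊ + 1 : ℕ) ≤ 3 * (h / √(Real.log h)) := by
  have hfl : (⌊h⌋₊ : ℝ) ≤ h := Nat.floor_le (by linarith)
  have hfl2 : h < ⌊h⌋₊ + 1 := Nat.lt_floor_add_one h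
  have h1 : (1 : ℝ) ≤ ⌊h⌋₊ := by
    exact_mod_cast Nat.le_floor (by exact_mod_cast hh.le)
  set n : ℝ := ((2 * ⌊h⌋₊ + 1 : ℕ) : ℝ) with hn
  have hn' : n = 2 * ⌊h⌋₊ + 1 := by rw [hn]; push_cast; ring
  have hlh : 0 < Real.log h := Real.log_pos hh
  have hn3 : 3 ≤ n := by linarith
  have hln1 : 1 ≤ Real.log n := by
    rw [Real.le_log_iff_exp_le (by linarith)]
    exact (Real.exp_one_lt_d9.le.trans (by norm_num)).trans hn3
  have hsqrt : √(Real.log h) ≤ Real.log n := by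
    rw [Real.sqrt_le_left (by linarith)]
    have : Real.log h ≤ Real.log n := Real.log_le_log (by linarith) (by linarith)
    nlinarith
  rw [← mul_div_assoc]
  exact div_le_div₀ (by linarith) (by linarith) (Real.sqrt_pos.2 hlh) hsqrt

theorem one_le_div_sqrt_log {h : ℝ} (hh : 1 < h) : 1 ≤ h / √(Real.log h) := by
  have hlh : 0 < Real.log h := Real.log_pos hh
  rw [one_le_div (Real.sqrt_pos.2 hlh), Real.sqrt_le_left (by linarith)]
  nlinarith [Real.log_le_self (by linarith : 0 ≤ h)]

/-- The slack between `c` and `C` yields the strict inequality. -/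
theorem exp_neg_mul_lt {c C H X Y : ℝ} (hX : 0 < X) (hH : 0 < H) (hc : c < C)
    (h : X ≤ Real.exp (c * H) * Y) : Real.exp (-(C * H)) * X < Y := by
  have h1 : Real.exp (-(C * H)) < Real.exp (-(c * H)) := Real.exp_lt_exp.2 (by nlinarith)
  calc Real.exp (-(C * H)) * X < Real.exp (-(c * H)) * X := mul_lt_mul_of_pos_right h1 hX
    _ ≤ Real.exp (-(c * H)) * (Real.exp (c * H) * Y) :=
        mul_le_mul_of_nonneg_left h (Real.exp_pos _).le
    _ = Y := by rw [← mul_assoc, ← Real.exp_add, neg_add_cancel, Real.exp_zero, one_mul]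

theorem card_le_two_mul_card_filter {K : Type*} [Zero K] [DecidableEq K] {A : Finset K}
    (hA : ∃ a ∈ A, a ≠ 0) : (A.card : ℝ) ≤ 2 * (A.filter (· ≠ 0)).card := by
  obtain ⟨a, ha, ha0⟩ := hA
  have h1 : 1 ≤ (A.filter (· ≠ 0)).card := Finset.card_pos.2 ⟨a, Finset.mem_filter.2 ⟨ha, ha0⟩⟩
  have h2 : A.card ≤ (A.filter (· ≠ 0)).card + 1 := by
    rw [Finset.filter_ne' A 0]
    have := Finset.pred_card_le_card_erase (s := A) (a := (0 : K))
    omega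
  exact_mod_cast (by omega : A.card ≤ 2 * (A.filter (· ≠ 0)).card)

theorem hasDenominator_of_height_le {F : Type u} [Field F] {K : Type v} [Field K]
    [Algebra (RatFunc F) K] [FiniteDimensional (RatFunc F) K] {h : ℝ} {x : K} (hx : x ≠ 0)
    (hxh : (height F x : ℝ) ≤ h) :
    HasDenominator (polyHom F K) (2 * ⌊h⌋₊ + 1) x ∧
      HasDenominator (polyInvHom F K) (2 * ⌊h⌋₊ + 1) x := by
  have h1 : height F x ≤ ⌊h⌋₊ := Nat.le_floor hxh
  exact ⟨(hasDenominator_polyHom hx h1).mono (by omega),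
    (hasDenominator_polyInvHom hx h1).mono (by omega)⟩

end FunctionFieldHeight

open FunctionFieldHeight in
theorem mainTheorem3 (q d : ℕ) :
    (∃ C : ℝ, 0 < C ∧
      ∀ (F : Type u) [Field F] [Fintype F] (K : Type v) [Field K] [DecidableEq K]
        [Algebra (RatFunc F) K] [FiniteDimensional (RatFunc F) K],
        Fintype.card F = q → Module.finrank (RatFunc F) K = d →
        ∀ (h : ℝ), 1 < h → ∀ A B : Finset K,
          (∀ a ∈ A, (FunctionFieldHeight.height F a : ℝ) ≤ h) →
          (∀ b ∈ B, (FunctionFieldHeight.height F b : ℝ) ≤ h) →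
          (∃ a ∈ A, a ≠ 0) → (∃ b ∈ B, b ≠ 0) →
          ((A * B).card : ℝ) >
            Real.exp (-(C * (h / Real.sqrt (Real.log h)))) * ((A.card : ℝ) * (B.card : ℝ))) ∧
    (∀ ν : ℕ, 0 < ν → ∃ C : ℝ, 0 < C ∧
      ∀ (F : Type u) [Field F] [Fintype F] (K : Type v) [Field K] [DecidableEq K]
        [Algebra (RatFunc F) K] [FiniteDimensional (RatFunc F) K],
        Fintype.card F = q → Module.finrank (RatFunc F) K = d →
        ∀ (h : ℝ), 1 < h → ∀ A : Finset K, A.Nonempty →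
          (∀ a ∈ A, (FunctionFieldHeight.height F a : ℝ) ≤ h) →
          ((A ^ ν).card : ℝ) >
            Real.exp (-(C * (h / Real.sqrt (Real.log h)))) * (A.card : ℝ) ^ ν) := by
  by_cases hq : 2 ≤ q
  swap
  · have hF : ∀ (F : Type u) [Field F] [Fintype F], Fintype.card F ≠ q := by
      intro F _ _ h
      have := Fintype.one_lt_card (α := F)
      omega
    exact ⟨⟨1, one_pos, fun F _ _ K _ _ _ _ h => absurd h (hF F)⟩,
      fun ν _ => ⟨1, one_pos, fun F _ _ K _ _ _ _ h => absurd h (hF F)⟩⟩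
  have hexp2 : (2 : ℝ) ≤ Real.exp 1 := by linarith [Real.exp_one_gt_d9]
  have hn3 : ∀ {h : ℝ}, 1 < h → 3 ≤ 2 * ⌊h⌋₊ + 1 := by
    intro h hh
    have : 1 ≤ ⌊h⌋₊ := Nat.le_floor (by exact_mod_cast hh.le)
    omega
  refine ⟨?_, fun ν hν => ?_⟩
  · obtain ⟨C, hC, hmain⟩ := exists_card_mul_card_le.{u, v} q d hq
    -- The factor 3 in `3 * C` is that of `div_log_le`; of the added 3, two pay for removing zero
    -- from `A` and `B` (`2 ≤ exp H`), and one for strictness.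
    refine ⟨3 * C + 3, by positivity, ?_⟩
    intro F _ _ K _ _ _ _ hF hK h hh A B hA hB hA0 hB0
    set H := h / √(Real.log h) with hH
    have hH1 : 1 ≤ H := one_le_div_sqrt_log hh
    set A' := A.filter (· ≠ 0) with hA'
    set B' := B.filter (· ≠ 0) with hB'
    have hmem : ∀ x ∈ A' ∪ B', x ≠ 0 ∧ (height F x : ℝ) ≤ h := by
      intro x hx
      rcases Finset.mem_union.1 hx with hx | hx
      · exact ⟨(Finset.mem_filter.1 hx).2, hA x (Finset.mem_filter.1 hx).1⟩
      · exact ⟨(Finset.mem_filter.1 hx).2, hB x (Finset.mem_filter.1 hx).1⟩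
    have hbound := hmain F K (by rw [Nat.card_eq_fintype_card, hF]) hK _ (hn3 hh) A' B'
      (fun x hx => (hmem x hx).1)
      (fun x hx => (hasDenominator_of_height_le (hmem x hx).1 (hmem x hx).2).1)
      (fun x hx => (hasDenominator_of_height_le (hmem x hx).1 (hmem x hx).2).2)
    have hpos : (0 : ℝ) < A.card * B.card := by
      obtain ⟨a, ha, -⟩ := hA0
      obtain ⟨b, hb, -⟩ := hB0
      have := Finset.card_pos.2 ⟨a, ha⟩
      have := Finset.card_pos.2 ⟨b, hb⟩
      positivity
    refine exp_neg_mul_lt (c := 3 * C + 2) hpos (by linarith) (by linarith) ?_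
    have hsub : ((A' * B').card : ℝ) ≤ (A * B).card := by
      exact_mod_cast Finset.card_le_card
        (Finset.mul_subset_mul (Finset.filter_subset _ _) (Finset.filter_subset _ _))
    have h4 : (2 : ℝ) * 2 ≤ Real.exp (2 * H) := by
      rw [two_mul H, Real.exp_add]
      have : (2 : ℝ) ≤ Real.exp H := hexp2.trans (Real.exp_le_exp.2 hH1)
      exact mul_le_mul this this (by norm_num) (by positivity)
    calc (A.card : ℝ) * B.card ≤ (2 * A'.card) * (2 * B'.card) :=
          mul_le_mul (card_le_two_mul_card_filter hA0) (card_le_two_mul_card_filter hB0)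
            (by positivity) (by positivity)
      _ = (2 * 2) * (A'.card * B'.card) := by ring
      _ ≤ Real.exp (2 * H) * (Real.exp (C * (3 * H)) * (A * B).card) := by
          refine mul_le_mul h4 (hbound.trans ?_) (by positivity) (by positivity)
          refine mul_le_mul (Real.exp_le_exp.2 ?_) hsub (by positivity) (by positivity)
          exact mul_le_mul_of_nonneg_left (div_log_le hh) hC.le
      _ = _ := by rw [← mul_assoc, ← Real.exp_add]; congr 2; ring
  · obtain ⟨C, hC, hmain⟩ := exists_card_pow_le.{u, v} q d ν hq hν
    refine ⟨3 * C + ν + 1, by positivity, ?_⟩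
    intro F _ _ K _ _ _ _ hF hK h hh A hAne hA
    set H := h / √(Real.log h) with hH
    have hH1 : 1 ≤ H := one_le_div_sqrt_log hh
    have hpos : (0 : ℝ) < (A.card : ℝ) ^ ν := by
      have := Finset.card_pos.2 hAne
      positivity
    refine exp_neg_mul_lt (c := 3 * C + ν) hpos (by linarith) (by linarith) ?_
    by_cases hA0 : ∃ a ∈ A, a ≠ 0
    · set A' := A.filter (· ≠ 0) with hA'
      have hmem : ∀ x ∈ A', x ≠ 0 ∧ (height F x : ℝ) ≤ h := fun x hx =>
        ⟨(Finset.mem_filter.1 hx).2, hA x (Finset.mem_filter.1 hx).1⟩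
      have hbound := hmain F K (by rw [Nat.card_eq_fintype_card, hF]) hK _ (hn3 hh) A'
        (fun x hx => (hmem x hx).1)
        (fun x hx => (hasDenominator_of_height_le (hmem x hx).1 (hmem x hx).2).1)
        (fun x hx => (hasDenominator_of_height_le (hmem x hx).1 (hmem x hx).2).2)
      have hsub : ((A' ^ ν).card : ℝ) ≤ (A ^ ν).card := by
        exact_mod_cast Finset.card_le_card (Finset.pow_subset_pow_left (Finset.filter_subset _ _))
      have h2 : (2 : ℝ) ^ ν ≤ Real.exp (ν * H) := by
        rw [Real.exp_nat_mul]
        exact pow_le_pow_left₀ (by norm_num) (hexp2.trans (Real.exp_le_exp.2 hH1)) ν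
      calc (A.card : ℝ) ^ ν ≤ (2 * A'.card) ^ ν :=
            pow_le_pow_left₀ (by positivity) (card_le_two_mul_card_filter hA0) ν
        _ = 2 ^ ν * (A'.card : ℝ) ^ ν := mul_pow _ _ _
        _ ≤ Real.exp (ν * H) * (Real.exp (C * (3 * H)) * (A ^ ν).card) := by
            refine mul_le_mul h2 (hbound.trans ?_) (by positivity) (by positivity)
            refine mul_le_mul (Real.exp_le_exp.2 ?_) hsub (by positivity) (by positivity)
            exact mul_le_mul_of_nonneg_left (div_log_le hh) hC.le
        _ = _ := by rw [← mul_assoc, ← Real.exp_add]; congr 2; ring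
    -- Here `A` is `{0}`, so both sizes are 1.
    · push Not at hA0
      have hA1 : A.card ≤ 1 := Finset.card_le_one.2 fun a ha b hb => by rw [hA0 a ha, hA0 b hb]
      have h1 : (A.card : ℝ) ^ ν ≤ 1 := pow_le_one₀ (by positivity) (by exact_mod_cast hA1)
      have h2 : (1 : ℝ) ≤ (A ^ ν).card := by
        exact_mod_cast Finset.card_pos.2 hAne.pow
      have h3 : 1 ≤ Real.exp ((3 * C + ν) * H) := Real.one_le_exp (by positivity)
      nlinarith
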